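/- Let $\mathbb{B}^n$ be the open Euclidean unit ball of $\mathbb{C}^n$ and let $\phi:\mathbb{B}^n\to\mathbb{B}^n$ be analytic with $\phi(0)=0$ and with invertible derivative $\phi'(0)$. Suppose that $\phi$ is not unitary on any slice, that is, there are no unit vectors $\zeta,\eta\in\mathbb{C}^n$ such that $\phi(\lambda\zeta)=\lambda\eta$ for all $\lambda\in\mathbb{C}$ with $|\lambda|<1$. For $G:\mathbb{B}^n\to(0,\infty)$ let $A_G^2(\mathbb{B}^n)$ be the space of analytic $f:\mathbb{B}^n\to\mathbb{C}$ with $$\|f\|^2=\int_{\mathbb{B}^n}|f(z)|^2\,G(z)\,dz<\infty ,$$ where $dz$ is Lebesgue measure on $\mathbb{R}^{2n}$, and let $C_\phi$ denote composition with $\phi$. Then there exists an analytic $F=(f_1,\dots,f_n)^t:\mathbb{B}^n\to\mathbb{C}^n$ satisfying Schroeder's equation $$C_\phi F=\phi'(0)F,\qquad\text{i.e. } F(\phi(z))=\phi'(0)F(z)\quad(z\in\mathbb{B}^n),$$ such that the component functions $f_1,\dots,f_n$ belong to $A_G^2(\mathbb{B}^n)$ and are linearly independent there, for each of the following weights $G$: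 1. every $G(z)=g(|z|)$ with $g:[0,1)\to(0,\infty)$ continuous and non-increasing and such that, for every $\rho>1$, the quotient $$\frac{g(r)}{(1-r)^{2n}\,g(1-\rho(1-r))}$$ is bounded for $r$ near $1$ (for example $g(r)=\exp(-q/(1-r))$ with $q>0$); 2. every continuous $G:\mathbb{B}^n\to(0,\infty)$ with $\int_{\mathbb{B}^n}G(z)\,dz<\infty$ for which $C_\phi$ is a compact operator on $A_G^2(\mathbb{B}^n)$. -/

import Mathlib

open Set Filter Topology MeasureTheory

/-- `ℂⁿ` with its Euclidean norm. -/
abbrev Cn (n : ℕ) : Type := EuclideanSpace ℂ (Fin n)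

/-- The open unit ball of `ℂⁿ`. -/
abbrev unitBall (n : ℕ) : Set (Cn n) := Metric.ball 0 1

/-- `φ` is unitary on some slice: there are unit vectors `ζ, η` with `φ(λζ) = λη` for all `λ` in
the open unit disc. -/
def UnitaryOnSomeSlice {n : ℕ} (φ : Cn n → Cn n) : Prop :=
  ∃ ζ η : Cn n, ‖ζ‖ = 1 ∧ ‖η‖ = 1 ∧ ∀ c : ℂ, ‖c‖ < 1 → φ (c • ζ) = c • η

/-- The measure `G(z) dz` on the unit ball (`dz` is Lebesgue measure on `ℂⁿ = ℝ²ⁿ`). -/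
noncomputable def weightMeasure {n : ℕ} (G : Cn n → ℝ) : Measure (Cn n) :=
  (volume.restrict (unitBall n)).withDensity fun z => ENNReal.ofReal (G z)

/-- The weighted Bergman space `A²_G(𝔹ⁿ)`: the subspace of `L²(𝔹ⁿ, G dz)`, with the norm
`‖f‖² = ∫ |f|² G dz`, of (classes of) functions that are analytic on the ball. -/
noncomputable def bergmanSpace {n : ℕ} (G : Cn n → ℝ) :
    Submodule ℂ (Lp ℂ 2 (weightMeasure G)) where
  carrier := {f | ∃ g : Cn n → ℂ, AnalyticOnNhd ℂ g (unitBall n) ∧ f =ᵐ[weightMeasure G] g}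
  zero_mem' := ⟨fun _ => 0, analyticOnNhd_const, Lp.coeFn_zero _ _ _⟩
  add_mem' := by
    rintro f₁ f₂ ⟨g₁, h₁, e₁⟩ ⟨g₂, h₂, e₂⟩
    exact ⟨g₁ + g₂, h₁.add h₂, (Lp.coeFn_add f₁ f₂).trans (e₁.add e₂)⟩
  smul_mem' := by
    rintro c f ⟨g, h, e⟩
    exact ⟨c • g, h.const_smul, (Lp.coeFn_smul c f).trans (e.const_smul c)⟩

/-- The composition operator `f ↦ f ∘ φ` maps `A²_G(𝔹ⁿ)` into itself and is compact there. -/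
def CompositionCompact {n : ℕ} (φ : Cn n → Cn n) (G : Cn n → ℝ) : Prop :=
  ∃ T : bergmanSpace G →L[ℂ] bergmanSpace G, IsCompactOperator T ∧
    ∀ (f : bergmanSpace G) (g : Cn n → ℂ), AnalyticOnNhd ℂ g (unitBall n) →
      (f : Lp ℂ 2 (weightMeasure G)) =ᵐ[weightMeasure G] g →
      (T f : Lp ℂ 2 (weightMeasure G)) =ᵐ[weightMeasure G] g ∘ φ

/-- The component functions of `F` belong to `A²_G(𝔹ⁿ)` and are linearly independent there. -/
def ComponentsLinearIndependent {n : ℕ} (F : Cn n → Cn n) (G : Cn n → ℝ) : Prop :=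
  ∃ f : Fin n → bergmanSpace G,
    (∀ i, (f i : Lp ℂ 2 (weightMeasure G)) =ᵐ[weightMeasure G] fun z => F z i) ∧
      LinearIndependent ℂ f

/-- A continuous, non-increasing `g : [0,1) → (0,∞)` such that, for every `ρ > 1`,
`g(r) / ((1-r)²ⁿ g(1-ρ(1-r)))` is bounded for `r` near `1`. -/
structure RapidlyDecreasingWeight (n : ℕ) (g : ℝ → ℝ) : Prop where
  continuousOn : ContinuousOn g (Ico 0 1)
  antitoneOn : AntitoneOn g (Ico 0 1)
  pos : ∀ r ∈ Ico (0 : ℝ) 1, 0 < g r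
  bounded : ∀ ρ : ℝ, 1 < ρ → ∃ C : ℝ, ∀ᶠ r in 𝓝[<] (1 : ℝ),
    g r / ((1 - r) ^ (2 * n) * g (1 - ρ * (1 - r))) ≤ C

/-- A continuous weight `G : 𝔹ⁿ → (0,∞)` with `∫ G dz < ∞`; the last condition says that `A²_G(𝔹ⁿ)`
contains the constants, equivalently all polynomials. -/
structure BergmanWeight {n : ℕ} (G : Cn n → ℝ) : Prop where
  continuousOn : ContinuousOn G (unitBall n)
  pos : ∀ z ∈ unitBall n, 0 < G z
  integrableOn : IntegrableOn G (unitBall n)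

/-! Write A for the derivative of φ at 0. Since φ is unitary on no slice, the equality case of the
Schwarz lemma gives ‖A‖ < 1, and a Schwarz-Pick argument gives |φ(z)| ≤ |z|(1 - c(1 - |z|)) with c >
0. Hence orbits tend to 0 like α^k, with one α < 1 for all of them (`exists_iterate_norm_le`).

Fix m with ‖A⁻¹‖α^m < 1. If P solves Schroeder's equation up to O(|z|^m), then A⁻ᵏ P(φᵏ(z))
converges to an exact solution F with F - P = O(|z|^m) (`exists_schroeder_of_approx`). An exact
solution that is itself O(|z|^m) is zero (`schroeder_eq_zero_of_isBigO`).

Resonances among the eigenvalues of A may prevent P from having invertible derivative, so P is found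
by linear algebra. Composition with φ acts on the finite dimensional space of jets of order < m, and
taking the derivative at 0 exhibits l ↦ l ∘ A as a quotient of this action. Every matrix is similar
to its transpose, so a quotient of an endomorphism is also a restriction of it
(`exists_injective_intertwining_of_surjective`). This yields n independent jets on which composition
acts through A, and the components of F inherit their independence.

Membership of this one F in the weighted spaces has two proofs. For a rapidly decreasing g, near the
boundary the decay of g absorbs ‖A⁻¹‖², so g(|z|)|F(z)|² does not decrease from z to φ(z); following
orbits into a compact ball bounds it (`exists_weight_mul_norm_sq_le`). If the composition operator
is compact, the Fredholm alternative on functions vanishing to high order gives H in the space such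
that P + H solves the equation, and uniqueness gives F = P + H (`memLp_of_compositionCompact`). -/

open scoped ContDiff

/-! ### Analyticity and locally uniform limits in several complex variables -/

/-- Cauchy estimates for all iterated derivatives of a bounded smooth function on a complex
normed space. -/
theorem norm_iteratedFDeriv_le_of_bounded {E F : Type*} [NormedAddCommGroup E] [NormedSpace ℂ E]
    [NormedAddCommGroup F] [NormedSpace ℂ F] {f : E → F} {V : Set E} (hV : IsOpen V)
    (hf : ContDiffOn ℂ ∞ f V) {M : ℝ} (hM : ∀ x ∈ V, ‖f x‖ ≤ M) {s : ℝ} (hs : 0 < s) (j : ℕ) :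
    ∀ y, Metric.ball y ((j + 1) * s) ⊆ V → ‖iteratedFDeriv ℂ j f y‖ ≤ M * (2 / s) ^ j := by
  induction j with
  | zero =>
    intro y hy
    simpa using hM y (hy (by simpa using hs))
  | succ j ih =>
    intro y hy
    have hsub : ∀ w ∈ Metric.ball y s, Metric.ball w ((j + 1) * s) ⊆ V := by
      intro w hw
      refine (Metric.ball_subset_ball' ?_).trans hy
      rw [Metric.mem_ball] at hw
      push_cast
      linarith
    have hyV : ∀ w ∈ Metric.ball y s, w ∈ V := fun w hw =>
      hsub w hw (Metric.mem_ball_self (by positivity))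
    have hb : ∀ w ∈ Metric.ball y s, ‖iteratedFDeriv ℂ j f w‖ ≤ M * (2 / s) ^ j :=
      fun w hw => ih w (hsub w hw)
    have hd : DifferentiableOn ℂ (iteratedFDeriv ℂ j f) (Metric.ball y s) := by
      intro w hw
      have h1 : ContDiffAt ℂ ∞ f w := hf.contDiffAt (hV.mem_nhds (hyV w hw))
      exact (h1.differentiableAt_iteratedFDeriv
        (by exact_mod_cast ENat.natCast_lt_top j)).differentiableWithinAt
    -- The Cauchy estimate wants values in a ball about the value at the centre; recentring costs
    -- the factor 2.
    have hmaps : MapsTo (iteratedFDeriv ℂ j f) (Metric.ball y s)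
        (Metric.closedBall (iteratedFDeriv ℂ j f y) (2 * (M * (2 / s) ^ j))) := by
      intro w hw
      rw [Metric.mem_closedBall, dist_eq_norm]
      have := norm_sub_le (iteratedFDeriv ℂ j f w) (iteratedFDeriv ℂ j f y)
      linarith [hb w hw, hb y (Metric.mem_ball_self hs)]
    have := Complex.norm_fderiv_le_div_of_mapsTo_ball hd hmaps hs
    rw [norm_fderiv_iteratedFDeriv] at this
    refine this.trans (le_of_eq ?_)
    rw [pow_succ]
    ring

/-- Derivatives of a smooth function along a complex line. -/
theorem iteratedDeriv_comp_line {E F : Type*} [NormedAddCommGroup E] [NormedSpace ℂ E]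
    [NormedAddCommGroup F] [NormedSpace ℂ F] {f : E → F} {V : Set E} (hV : IsOpen V)
    (hf : ContDiffOn ℂ ∞ f V) (x y : E) (j : ℕ) :
    ∀ t : ℂ, x + t • y ∈ V →
      iteratedDeriv j (fun t : ℂ => f (x + t • y)) t =
        iteratedFDeriv ℂ j f (x + t • y) (fun _ => y) := by
  induction j with
  | zero => intro t _; simp
  | succ j ih =>
    intro t ht
    have hop : IsOpen {t : ℂ | x + t • y ∈ V} := hV.preimage (by fun_prop)
    have hev : iteratedDeriv j (fun t : ℂ => f (x + t • y)) =ᶠ[𝓝 t]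
        fun t => iteratedFDeriv ℂ j f (x + t • y) (fun _ => y) := by
      filter_upwards [hop.mem_nhds ht] with u hu using ih u hu
    rw [iteratedDeriv_succ, hev.deriv_eq]
    have h1 : ContDiffAt ℂ ∞ f (x + t • y) := hf.contDiffAt (hV.mem_nhds ht)
    have h2 := (h1.differentiableAt_iteratedFDeriv (m := j)
        (by exact_mod_cast ENat.natCast_lt_top j)).hasFDerivAt
    have h3 : HasDerivAt (fun t : ℂ => x + t • y) y t := by
      simpa using ((hasDerivAt_id t).smul_const y).const_add x
    have h4 := h2.comp_hasDerivAt t h3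
    have h5 := (ContinuousMultilinearMap.apply ℂ (fun _ : Fin j => E) F
      (fun _ => y)).hasFDerivAt.comp_hasDerivAt t h4
    refine h5.deriv.trans ?_
    rw [iteratedFDeriv_succ_apply_left]
    rfl

/-- A complex smooth function on an open set is analytic. -/
theorem ContDiffOn.analyticOnNhd_complex {E F : Type*} [NormedAddCommGroup E] [NormedSpace ℂ E]
    [NormedAddCommGroup F] [NormedSpace ℂ F] [CompleteSpace F] {f : E → F} {U : Set E}
    (hU : IsOpen U) (hf : ContDiffOn ℂ ∞ f U) : AnalyticOnNhd ℂ f U := by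
  intro x hx
  obtain ⟨ρ, hρ, hρU, M, hM⟩ : ∃ ρ > 0, Metric.ball x ρ ⊆ U ∧ ∃ M, ∀ y ∈ Metric.ball x ρ,
      ‖f y‖ ≤ M := by
    have hc : ContinuousAt f x := hf.continuousOn.continuousAt (hU.mem_nhds hx)
    have h1 : ∀ᶠ y in 𝓝 x, ‖f y‖ < ‖f x‖ + 1 :=
      hc.norm.eventually_lt continuousAt_const (by simp)
    obtain ⟨ρ, hρ, h⟩ := Metric.eventually_nhds_iff_ball.1 (h1.and (hU.mem_nhds hx))
    exact ⟨ρ, hρ, fun y hy => (h y hy).2, ‖f x‖ + 1, fun y hy => (h y hy).1.le⟩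
  have hM0 : 0 ≤ M := (norm_nonneg _).trans (hM x (Metric.mem_ball_self hρ))
  have hfV := hf.mono hρU
  -- The step ρ / (m + 1) lets the m + 1 radii fill the ball. The price (m + 1)^m / m! is at most
  -- e^(m+1), hence only geometric in m.
  have hbound : ∀ m : ℕ, ‖iteratedFDeriv ℂ m f x‖ / m.factorial ≤
      M * Real.exp 1 * (2 * Real.exp 1 / ρ) ^ m := by
    intro m
    have h1 := norm_iteratedFDeriv_le_of_bounded Metric.isOpen_ball hfV hM
      (s := ρ / (m + 1)) (by positivity) m x
      (by rw [mul_div_cancel₀ _ (by positivity : (m + 1 : ℝ) ≠ 0)])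
    have h2 := Real.pow_div_factorial_le_exp (m + 1 : ℝ) (by positivity) (m + 1)
    have h3 : ((m : ℝ) + 1) ^ m / m.factorial ≤ Real.exp 1 ^ (m + 1) := by
      rw [← Real.exp_nat_mul]
      refine le_trans (le_of_eq ?_) (h2.trans (le_of_eq ?_))
      · rw [Nat.factorial_succ, pow_succ]
        push_cast
        field_simp
      · push_cast; ring_nf
    calc ‖iteratedFDeriv ℂ m f x‖ / m.factorial
        ≤ M * (2 / (ρ / (m + 1))) ^ m / m.factorial := by gcongr
      _ = M * (2 / ρ) ^ m * (((m : ℝ) + 1) ^ m / m.factorial) := by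
          rw [show (2 : ℝ) / (ρ / (m + 1)) = 2 / ρ * (m + 1) by field_simp, mul_pow]; ring
      _ ≤ M * (2 / ρ) ^ m * Real.exp 1 ^ (m + 1) := by gcongr
      _ = _ := by rw [pow_succ, mul_div_right_comm, mul_pow]; ring
  let p : FormalMultilinearSeries ℂ E F := fun m =>
    ((m.factorial : ℂ)⁻¹) • iteratedFDeriv ℂ m f x
  have hpn : ∀ m, ‖p m‖ = ‖iteratedFDeriv ℂ m f x‖ / m.factorial := by
    intro m
    simp only [p, norm_smul, norm_inv, Complex.norm_natCast]
    ring
  set r : ℝ := ρ / (2 * Real.exp 1) with hr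
  have hr0 : 0 < r := by positivity
  have hrρ : r ≤ ρ := by
    rw [hr]
    apply div_le_self hρ.le
    have := Real.add_one_le_exp (1 : ℝ)
    linarith
  refine ⟨p, ENNReal.ofReal r, ?_, by simpa using hr0, ?_⟩
  · refine p.le_radius_of_bound (M * Real.exp 1) (r := r.toNNReal) fun m => ?_
    rw [hpn, Real.coe_toNNReal _ hr0.le]
    calc _ ≤ M * Real.exp 1 * (2 * Real.exp 1 / ρ) ^ m * r ^ m := by gcongr; exact hbound m
      _ = M * Real.exp 1 := by
        rw [mul_assoc, ← mul_pow, hr, div_mul_div_cancel₀ hρ.ne', div_self (by positivity)]; simp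
  · intro y hy
    have hy' : ‖y‖ < r := by
      rw [Metric.eball_ofReal] at hy
      simpa using hy
    -- The series is summed on the complex line through x in direction y: t ↦ f(x + ty) is
    -- holomorphic on a disc of radius R > 1, and its Taylor series is evaluated at t = 1.
    obtain ⟨R, hR1, hR⟩ : ∃ R : ℝ, 1 < R ∧ R * ‖y‖ < ρ := by
      rcases eq_or_ne y 0 with rfl | h0
      · exact ⟨2, by norm_num, by simpa using hρ⟩
      · have hpos : 0 < ‖y‖ := norm_pos_iff.2 h0
        obtain ⟨R, h1, h2⟩ := exists_between ((one_lt_div hpos).2 (hy'.trans_le hrρ))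
        exact ⟨R, h1, (lt_div_iff₀ hpos).1 h2⟩
    have hmem : ∀ t ∈ Metric.ball (0 : ℂ) R, x + t • y ∈ Metric.ball x ρ := by
      intro t ht
      rw [mem_ball_zero_iff] at ht
      rw [Metric.mem_ball, dist_eq_norm, add_sub_cancel_left, norm_smul]
      exact (mul_le_mul_of_nonneg_right ht.le (norm_nonneg _)).trans_lt hR
    have hd : DifferentiableOn ℂ (fun t : ℂ => f (x + t • y)) (Metric.ball 0 R) := by
      refine (hfV.differentiableOn (by simp)).comp ?_ hmem
      fun_prop
    have hs := Complex.hasSum_taylorSeries_on_ball hd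
      (z := 1) (by simpa using hR1)
    simp only [sub_zero, one_pow, one_smul] at hs
    convert hs using 2 with m
    rw [iteratedDeriv_comp_line Metric.isOpen_ball hfV x y m 0 (by simpa using hρ)]
    simp [p]

/-- The derivatives of a locally uniformly convergent sequence of holomorphic maps converge locally
uniformly. -/
theorem TendstoLocallyUniformlyOn.exists_fderiv_limit {E F : Type*} [NormedAddCommGroup E]
    [NormedSpace ℂ E] [LocallyCompactSpace E] [NormedAddCommGroup F] [NormedSpace ℂ F] [CompleteSpace F]
    {f : ℕ → E → F} {U : Set E}
    (hU : IsOpen U) (hf : ∀ k, DifferentiableOn ℂ (f k) U) {g : E → F}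
    (hg : TendstoLocallyUniformlyOn f g atTop U) :
    ∃ g' : E → E →L[ℂ] F, TendstoLocallyUniformlyOn (fun k => fderiv ℂ (f k)) g' atTop U := by
  have key : ∀ x ∈ U, ∃ δ > 0, UniformCauchySeqOn (fun k => fderiv ℂ (f k)) atTop
      (Metric.ball x δ) := by
    intro x hx
    have hloc : ∀ x ∈ U, ∃ v ∈ 𝓝[U] x, TendstoUniformlyOn f g atTop v :=
      ((tendstoLocallyUniformlyOn_TFAE f g atTop hU).out 0 2).1 hg
    obtain ⟨t, ht, htu⟩ := hloc x hx
    rw [hU.nhdsWithin_eq hx] at ht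
    obtain ⟨ρ, hρ, hρt⟩ := Metric.mem_nhds_iff.1 (inter_mem ht (hU.mem_nhds hx))
    have hc := (htu.mono (hρt.trans inter_subset_left)).uniformCauchySeqOn
    refine ⟨ρ / 2, by positivity, ?_⟩
    rw [Metric.uniformCauchySeqOn_iff] at hc ⊢
    intro ε hε
    -- Two values of f m - f n differ by less than ερ/4; dividing by the radius ρ/2 leaves ε/2.
    obtain ⟨N, hN⟩ := hc (ε * ρ / 8) (by positivity)
    refine ⟨N, fun m hm n hn y hy => ?_⟩
    have hsub : Metric.ball y (ρ / 2) ⊆ Metric.ball x ρ := by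
      apply Metric.ball_subset_ball'
      rw [Metric.mem_ball] at hy
      linarith
    have hdm : ∀ k, DifferentiableOn ℂ (f k) (Metric.ball y (ρ / 2)) := fun k =>
      (hf k).mono (hsub.trans (hρt.trans inter_subset_right))
    have hat : ∀ k, DifferentiableAt ℂ (f k) y := fun k =>
      (hdm k).differentiableAt (Metric.ball_mem_nhds _ (by positivity))
    rw [dist_eq_norm, ← fderiv_sub (hat m) (hat n)]
    refine (Complex.norm_fderiv_le_div_of_mapsTo_ball (R₂ := ε * ρ / 4) ((hdm m).sub (hdm n)) ?_
      (by positivity)).trans_lt ?_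
    · intro w hw
      have h1 := hN m hm n hn w (hsub hw)
      have h2 := hN m hm n hn y (hsub (Metric.mem_ball_self (by positivity)))
      rw [dist_eq_norm] at h1 h2
      rw [Metric.mem_closedBall, dist_eq_norm]
      have := norm_sub_le (f m w - f n w) (f m y - f n y)
      simp only [Pi.sub_apply]
      linarith
    · rw [div_lt_iff₀ (by positivity)]
      nlinarith
  have hlim : ∀ x ∈ U, ∃ l, Tendsto (fun k => fderiv ℂ (f k) x) atTop (𝓝 l) := by
    intro x hx
    obtain ⟨δ, hδ, h⟩ := key x hx
    exact cauchySeq_tendsto_of_complete (h.cauchySeq (Metric.mem_ball_self hδ))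
  choose! g' hg' using hlim
  refine ⟨g', tendstoLocallyUniformlyOn_of_forall_exists_nhds fun x hx => ?_⟩
  obtain ⟨δ, hδ, h⟩ := key x hx
  refine ⟨Metric.ball x δ ∩ U, nhdsWithin_le_nhds (inter_mem (Metric.ball_mem_nhds _ hδ)
    (hU.mem_nhds hx)), ?_⟩
  exact (h.mono inter_subset_left).tendstoUniformlyOn_of_tendsto fun y hy => hg' y hy.2

/-- The derivatives again converge locally uniformly, so the induction passes to maps with values in
`E →L[ℂ] F`. This is why F is quantified inside the statement and shares its universe with E. -/
theorem TendstoLocallyUniformlyOn.contDiffOn_complex {E : Type u} [NormedAddCommGroup E]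
    [NormedSpace ℂ E] [LocallyCompactSpace E] {U : Set E} (hU : IsOpen U) (m : ℕ) :
    ∀ {F : Type u} [NormedAddCommGroup F] [NormedSpace ℂ F] [CompleteSpace F]
      {f : ℕ → E → F} {g : E → F}, (∀ k, AnalyticOnNhd ℂ (f k) U) →
      TendstoLocallyUniformlyOn f g atTop U → ContDiffOn ℂ m g U := by
  induction m with
  | zero =>
    intro F _ _ _ f g hf hg
    rw [Nat.cast_zero, contDiffOn_zero]
    exact hg.continuousOn (Frequently.of_forall fun k => (hf k).continuousOn)
  | succ m ih =>
    intro F _ _ _ f g hf hg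
    obtain ⟨g', hg'⟩ := TendstoLocallyUniformlyOn.exists_fderiv_limit hU
      (fun k => (hf k).differentiableOn) hg
    have hd : ∀ x ∈ U, HasFDerivAt g (g' x) x := fun x hx =>
      hasFDerivAt_of_tendstoLocallyUniformlyOn hU hg'
        (fun k x hx => (hf k x hx).differentiableAt.hasFDerivAt)
        (fun x hx => hg.tendsto_at hx) hx
    have := ih (fun k => (hf k).fderiv) hg'
    push_cast
    rw [contDiffOn_succ_iff_hasFDerivWithinAt_of_uniqueDiffOn hU.uniqueDiffOn]
    exact ⟨by simp, g', this, fun x hx => (hd x hx).hasFDerivWithinAt⟩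

/-- A locally uniform limit of analytic functions on an open subset of a complex normed space is
analytic. -/
theorem TendstoLocallyUniformlyOn.analyticOnNhd_complex {E F : Type u} [NormedAddCommGroup E]
    [NormedSpace ℂ E] [LocallyCompactSpace E] [NormedAddCommGroup F] [NormedSpace ℂ F] [CompleteSpace F]
    {U : Set E} (hU : IsOpen U) {f : ℕ → E → F} {g : E → F}
    (hf : ∀ k, AnalyticOnNhd ℂ (f k) U) (hg : TendstoLocallyUniformlyOn f g atTop U) :
    AnalyticOnNhd ℂ g U :=
  ContDiffOn.analyticOnNhd_complex hU
    (contDiffOn_infty.2 fun m => hg.contDiffOn_complex hU m hf)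

/-! ### The Schwarz lemma and the convergence of orbits -/

/-- The derivative at a fixed origin of a self-map of the ball which is not unitary on any slice
is a strict contraction. -/
theorem norm_fderiv_lt_one_of_not_unitaryOnSomeSlice {n : ℕ} {φ : Cn n → Cn n}
    (hφ : AnalyticOnNhd ℂ φ (unitBall n)) (hmaps : MapsTo φ (unitBall n) (unitBall n))
    (h0 : φ 0 = 0) (hslice : ¬ UnitaryOnSomeSlice φ) : ‖fderiv ℂ φ 0‖ < 1 := by
  by_contra! hge
  apply hslice
  set A := fderiv ℂ φ 0 with hA
  -- By compactness the norm of A is attained, at a vector that turns out to be a unit vector with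
  -- unit image; φ restricted to its slice is then extremal in the Schwarz lemma.
  obtain ⟨x, hx, hmax⟩ := (isCompact_closedBall (0 : Cn n) 1).exists_isMaxOn
    ⟨0, by simp⟩ (f := fun x => ‖A x‖) (by fun_prop)
  have hx1 : ‖x‖ ≤ 1 := by simpa using hx
  have hAx : 1 ≤ ‖A x‖ := by
    by_contra! hlt
    obtain ⟨y, hy1, hy2⟩ := ContinuousLinearMap.exists_lt_apply_of_lt_opNorm A
      (hlt.trans_le hge)
    exact absurd (hmax (by simpa using hy1.le : y ∈ Metric.closedBall (0 : Cn n) 1)) (not_le.2 hy2)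
  have hle : ‖A‖ ≤ 1 := Complex.norm_fderiv_le_one_of_mapsTo_ball hφ.differentiableOn
    (fun z hz => by rw [h0]; exact Metric.ball_subset_closedBall (hmaps hz)) one_pos
  have hAx' : ‖A x‖ ≤ ‖x‖ := (A.le_opNorm x).trans (mul_le_of_le_one_left (norm_nonneg _) hle)
  have hnx : ‖x‖ = 1 := le_antisymm hx1 (hAx.trans hAx')
  have hnA : ‖A x‖ = 1 := le_antisymm (hAx'.trans hx1) hAx
  refine ⟨x, A x, hnx, hnA, ?_⟩
  have hline : ∀ t ∈ Metric.ball (0 : ℂ) 1, t • x ∈ unitBall n := by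
    intro t ht
    simpa [norm_smul, hnx] using ht
  have hd : DifferentiableOn ℂ (fun t : ℂ => φ (t • x)) (Metric.ball 0 1) :=
    hφ.differentiableOn.comp (by fun_prop) hline
  have hm : MapsTo (fun t : ℂ => φ (t • x)) (Metric.ball 0 1)
      (Metric.closedBall ((fun t : ℂ => φ (t • x)) 0) 1) := by
    intro t ht
    simp only [zero_smul, h0]
    exact Metric.ball_subset_closedBall (hmaps (hline t ht))
  have hder : HasDerivAt (fun t : ℂ => φ (t • x)) (A x) 0 := by
    have h1 : HasFDerivAt φ A ((0 : ℂ) • x) := by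
      rw [zero_smul]
      exact (hφ 0 (by simp)).differentiableAt.hasFDerivAt
    have h2 : HasDerivAt (fun t : ℂ => t • x) x 0 := by
      simpa using (hasDerivAt_id (0 : ℂ)).smul_const x
    exact h1.comp_hasDerivAt 0 h2
  have := Complex.affine_of_mapsTo_ball_of_norm_dslope_eq_div hd hm (z₀ := 0) (by simp)
    (by rw [dslope_same, hder.deriv, hnA]; simp)
  intro t ht
  have h2 := this (by simpa using ht : t ∈ Metric.ball (0 : ℂ) 1)
  simpa [dslope_same, hder.deriv, h0] using h2

/-- A weak form of the Schwarz-Pick lemma. -/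
theorem norm_le_one_sub_of_mapsTo_closedBall {q : ℂ → ℂ}
    (hd : DifferentiableOn ℂ q (Metric.ball 0 1)) (hq : ∀ t ∈ Metric.ball (0 : ℂ) 1, ‖q t‖ ≤ 1)
    {a : ℝ} (ha : a < 1) (h0 : ‖q 0‖ ≤ a) {t : ℂ} (ht : ‖t‖ < 1) :
    ‖q t‖ ≤ 1 - (1 - a) ^ 2 / 2 * (1 - ‖t‖) := by
  set p := q 0 with hp
  have hden : ∀ u ∈ Metric.ball (0 : ℂ) 1, 1 - a ≤ ‖1 - (starRingEnd ℂ) p * q u‖ := by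
    intro u hu
    have h1 := norm_sub_norm_le (1 : ℂ) ((starRingEnd ℂ) p * q u)
    rw [norm_mul, norm_one, RCLike.norm_conj] at h1
    have h2 : ‖p‖ * ‖q u‖ ≤ a * 1 :=
      mul_le_mul h0 (hq u hu) (norm_nonneg _) ((norm_nonneg _).trans h0)
    linarith
  have hid : ∀ u, ‖1 - (starRingEnd ℂ) p * q u‖ ^ 2 - ‖q u - p‖ ^ 2 =
      (1 - ‖p‖ ^ 2) * (1 - ‖q u‖ ^ 2) := by
    intro u
    simp only [← Complex.normSq_eq_norm_sq, Complex.normSq_apply, Complex.sub_re, Complex.sub_im,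
      Complex.mul_re, Complex.mul_im, Complex.conj_re, Complex.conj_im, Complex.one_re,
      Complex.one_im]
    ring
  have ha0 : 0 ≤ a := (norm_nonneg _).trans h0
  have hp1 : ‖p‖ ^ 2 ≤ 1 := pow_le_one₀ (norm_nonneg _) (h0.trans ha.le)
  have hle : ∀ u ∈ Metric.ball (0 : ℂ) 1, ‖q u - p‖ ≤ ‖1 - (starRingEnd ℂ) p * q u‖ := by
    intro u hu
    refine (sq_le_sq₀ (norm_nonneg _) (norm_nonneg _)).1 ?_
    have : 0 ≤ (1 - ‖p‖ ^ 2) * (1 - ‖q u‖ ^ 2) :=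
      mul_nonneg (by linarith) (by linarith [pow_le_one₀ (norm_nonneg (q u)) (hq u hu) (n := 2)])
    linarith [hid u]
  -- The Möbius transform carrying q(0) to 0 makes the Schwarz lemma applicable.
  have hwd : DifferentiableOn ℂ (fun u => (q u - p) / (1 - (starRingEnd ℂ) p * q u))
      (Metric.ball 0 1) := by
    refine (hd.sub_const p).div ((hd.const_mul _).const_sub 1) fun u hu => ?_
    exact norm_pos_iff.1 (lt_of_lt_of_le (by linarith) (hden u hu))
  have hw : MapsTo (fun u => (q u - p) / (1 - (starRingEnd ℂ) p * q u)) (Metric.ball 0 1)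
      (Metric.closedBall 0 1) := by
    intro u hu
    rw [mem_closedBall_zero_iff, norm_div]
    exact div_le_one_of_le₀ (hle u hu) (norm_nonneg _)
  have hs := Complex.norm_le_norm_of_mapsTo_ball hwd hw (by simp [hp]) ht
  have htm : t ∈ Metric.ball (0 : ℂ) 1 := by simpa using ht
  have hpos : 0 < ‖1 - (starRingEnd ℂ) p * q t‖ := lt_of_lt_of_le (by linarith) (hden t htm)
  rw [norm_div, div_le_iff₀ hpos] at hs
  have h1 : ‖q t - p‖ ^ 2 ≤ ‖t‖ ^ 2 * ‖1 - (starRingEnd ℂ) p * q t‖ ^ 2 := by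
    rw [← mul_pow]; gcongr
  have h2 : (1 - a) ^ 2 ≤ ‖1 - (starRingEnd ℂ) p * q t‖ ^ 2 :=
    pow_le_pow_left₀ (by linarith) (hden t htm) 2
  have ht2 : ‖t‖ ^ 2 ≤ ‖t‖ := by nlinarith [norm_nonneg t]
  have h3 : (1 - ‖t‖) * (1 - a) ^ 2 ≤ (1 - ‖p‖ ^ 2) * (1 - ‖q t‖ ^ 2) := by
    calc (1 - ‖t‖) * (1 - a) ^ 2 ≤ (1 - ‖t‖ ^ 2) * ‖1 - (starRingEnd ℂ) p * q t‖ ^ 2 :=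
          mul_le_mul (by linarith) h2 (by positivity) (by linarith)
      _ ≤ _ := by linarith [hid t]
  have h4 : (1 - ‖p‖ ^ 2) * (1 - ‖q t‖ ^ 2) ≤ 1 - ‖q t‖ ^ 2 :=
    mul_le_of_le_one_left (by linarith [pow_le_one₀ (norm_nonneg (q t)) (hq t htm) (n := 2)])
      (by linarith [sq_nonneg ‖p‖])
  -- The factor 1/2 comes from 1 - |q|² ≤ 2(1 - |q|).
  nlinarith [norm_nonneg (q t), hq t htm]

/-- Compose φ on the slice through z with a functional norming φ(z) and divide by t. The quotient is
bounded by 1 and its value at 0 by ‖φ'(0)‖ < 1, so weak Schwarz-Pick applies at t = |z|. The gain,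
linear in the distance to the sphere, drives both the decay of orbits and the comparison of weights.
-/
theorem exists_norm_le_mul_one_sub {n : ℕ} {φ : Cn n → Cn n}
    (hφ : AnalyticOnNhd ℂ φ (unitBall n)) (hmaps : MapsTo φ (unitBall n) (unitBall n))
    (h0 : φ 0 = 0) (hA : ‖fderiv ℂ φ 0‖ < 1) :
    ∃ c : ℝ, 0 < c ∧ c ≤ 1 / 2 ∧ ∀ z ∈ unitBall n, ‖φ z‖ ≤ ‖z‖ * (1 - c * (1 - ‖z‖)) := by
  set a := ‖fderiv ℂ φ 0‖ with ha
  have ha0 : 0 ≤ a := norm_nonneg _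
  refine ⟨(1 - a) ^ 2 / 2, by have : 0 < 1 - a := by linarith
                              positivity, by nlinarith, fun z hz => ?_⟩
  have hz1 : ‖z‖ < 1 := by simpa using hz
  rcases eq_or_ne (φ z) 0 with hzero | hne
  · rw [hzero, norm_zero]
    refine mul_nonneg (norm_nonneg _) ?_
    nlinarith [norm_nonneg z]
  have hz0 : z ≠ 0 := by rintro rfl; exact hne h0
  have hzpos : 0 < ‖z‖ := norm_pos_iff.2 hz0
  obtain ⟨g, hg, hgz⟩ := exists_dual_vector ℂ (φ z) (norm_ne_zero_iff.2 hne)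
  set x : Cn n := ((‖z‖⁻¹ : ℝ) : ℂ) • z with hx
  have hnx : ‖x‖ = 1 := by
    rw [hx, norm_smul, Complex.norm_real, norm_inv, norm_norm, inv_mul_cancel₀ hzpos.ne']
  have hline : ∀ t ∈ Metric.ball (0 : ℂ) 1, t • x ∈ unitBall n := by
    intro t ht
    simpa [norm_smul, hnx] using ht
  have hd : DifferentiableOn ℂ (fun t : ℂ => g (φ (t • x))) (Metric.ball 0 1) :=
    g.differentiable.comp_differentiableOn (hφ.differentiableOn.comp (by fun_prop) hline)
  have hm : MapsTo (fun t : ℂ => g (φ (t • x))) (Metric.ball 0 1)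
      (Metric.closedBall ((fun t : ℂ => g (φ (t • x))) 0) 1) := by
    intro t ht
    simp only [zero_smul, h0, map_zero]
    have h1 : ‖φ (t • x)‖ < 1 := by simpa using hmaps (hline t ht)
    rw [mem_closedBall_zero_iff]
    exact (g.le_opNorm _).trans (by rw [hg, one_mul]; exact h1.le)
  have hder : HasDerivAt (fun t : ℂ => g (φ (t • x))) (g (fderiv ℂ φ 0 x)) 0 := by
    have h1 : HasFDerivAt φ (fderiv ℂ φ 0) ((0 : ℂ) • x) := by
      rw [zero_smul]
      exact (hφ 0 (by simp)).differentiableAt.hasFDerivAt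
    have h2 : HasDerivAt (fun t : ℂ => t • x) x 0 := by
      simpa using (hasDerivAt_id (0 : ℂ)).smul_const x
    exact g.hasFDerivAt.comp_hasDerivAt 0 (h1.comp_hasDerivAt 0 h2)
  have hq0 : ‖dslope (fun t : ℂ => g (φ (t • x))) 0 0‖ ≤ a := by
    rw [dslope_same, hder.deriv]
    refine (g.le_opNorm _).trans ?_
    rw [hg, one_mul]
    exact ((fderiv ℂ φ 0).le_opNorm x).trans (by rw [hnx, mul_one])
  have hq := norm_le_one_sub_of_mapsTo_closedBall
    ((Complex.differentiableOn_dslope (Metric.ball_mem_nhds (0 : ℂ) one_pos)).2 hd)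
    (fun t ht => by simpa using Complex.norm_dslope_le_div_of_mapsTo_ball hd hm ht)
    hA hq0 (t := (‖z‖ : ℂ)) (by simpa using hz1)
  have hzx : (‖z‖ : ℂ) • x = z := by
    rw [hx, smul_smul, ← Complex.ofReal_mul, mul_inv_cancel₀ hzpos.ne']; simp
  rw [dslope_of_ne _ (by exact_mod_cast hzpos.ne'), slope_def_module] at hq
  simp only [hzx, hgz, zero_smul, h0, map_zero, sub_zero, norm_smul, norm_inv,
    Complex.norm_real, norm_norm] at hq
  have h3 : ‖((‖φ z‖ : ℝ) : ℂ)‖ = ‖φ z‖ := by simp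
  rw [inv_mul_le_iff₀ hzpos] at hq
  simpa using hq

theorem norm_iterate_le_of_norm_le {n : ℕ} {φ : Cn n → Cn n}
    (hle : ∀ z ∈ unitBall n, ‖φ z‖ ≤ ‖z‖) {z : Cn n} (hz : z ∈ unitBall n) (k : ℕ) :
    ‖φ^[k] z‖ ≤ ‖z‖ := by
  induction k with
  | zero => simp
  | succ k ih =>
    rw [Function.iterate_succ_apply']
    refine (hle _ ?_).trans ih
    rw [mem_ball_zero_iff] at hz ⊢
    exact ih.trans_lt hz

/-- Orbits converge to the origin geometrically, with a rate that does not depend on the orbit. -/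
theorem exists_iterate_norm_le {n : ℕ} {φ : Cn n → Cn n} {c : ℝ} (hc : 0 < c) (hc1 : c ≤ 1 / 2)
    (hφc : ∀ z ∈ unitBall n, ‖φ z‖ ≤ ‖z‖ * (1 - c * (1 - ‖z‖))) :
    ∃ α : ℝ, 0 < α ∧ α < 1 ∧ ∀ r < 1, ∃ K, 0 ≤ K ∧ ∀ z : Cn n, ‖z‖ ≤ r → ∀ k,
      ‖φ^[k] z‖ ≤ K * α ^ k * ‖z‖ := by
  have hmul : ∀ r < 1, ∀ z : Cn n, ‖z‖ ≤ r → ‖φ z‖ ≤ (1 - c * (1 - r)) * ‖z‖ := by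
    intro r hr z hz
    refine (hφc z (by rw [mem_ball_zero_iff]; linarith)).trans ?_
    rw [mul_comm]
    gcongr
  have hle : ∀ z ∈ unitBall n, ‖φ z‖ ≤ ‖z‖ := by
    intro z hz
    rw [mem_ball_zero_iff] at hz
    refine (hmul ‖z‖ hz z le_rfl).trans (mul_le_of_le_one_left (norm_nonneg _) ?_)
    nlinarith
  have hpow : ∀ r < 1, 0 ≤ r → ∀ z : Cn n, ‖z‖ ≤ r → ∀ k,
      ‖φ^[k] z‖ ≤ (1 - c * (1 - r)) ^ k * ‖z‖ := by
    intro r hr hr0 z hz k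
    have hzb : z ∈ unitBall n := by rw [mem_ball_zero_iff]; linarith
    induction k with
    | zero => simp
    | succ k ih =>
      rw [Function.iterate_succ_apply']
      refine (hmul r hr _ ((norm_iterate_le_of_norm_le hle hzb k).trans hz)).trans ?_
      rw [pow_succ', mul_assoc]
      have : 0 ≤ 1 - c * (1 - r) := by nlinarith
      gcongr
  -- α is the contraction factor on the ball of radius 1/2. Points with |z| ≤ r reach that ball
  -- within a common number k₀ of steps, and the constant (α^k₀)⁻¹ pays for these.
  set α := 1 - c * (1 - 1 / 2) with hα
  have hα0 : 0 < α := by rw [hα]; linarith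
  have hα1 : α < 1 := by rw [hα]; linarith
  refine ⟨α, hα0, hα1, fun r hr => ?_⟩
  rcases lt_or_ge r 0 with hneg | hr0
  · exact ⟨0, le_rfl, fun z hz => absurd (norm_nonneg z) (by linarith)⟩
  have hβ0 : 0 ≤ 1 - c * (1 - r) := by nlinarith
  have hβ1 : 1 - c * (1 - r) < 1 := by nlinarith
  obtain ⟨k₀, hk₀⟩ := exists_pow_lt_of_lt_one (by norm_num : (0 : ℝ) < 1 / 2) hβ1
  refine ⟨(α ^ k₀)⁻¹, by positivity, fun z hz k => ?_⟩
  have hzb : z ∈ unitBall n := by rw [mem_ball_zero_iff]; linarith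
  rcases le_total k k₀ with hk | hk
  · refine (norm_iterate_le_of_norm_le hle hzb k).trans (le_mul_of_one_le_left (norm_nonneg _) ?_)
    rw [inv_mul_eq_div, one_le_div (by positivity)]
    exact pow_le_pow_of_le_one hα0.le hα1.le hk
  · obtain ⟨j, rfl⟩ := Nat.exists_eq_add_of_le hk
    have hsmall : ‖φ^[k₀] z‖ ≤ 1 / 2 := by
      refine (hpow r hr hr0 z hz k₀).trans ?_
      nlinarith [norm_nonneg z]
    rw [add_comm, Function.iterate_add_apply, pow_add, mul_comm (α ^ j), inv_mul_cancel_left₀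
      (by positivity)]
    refine (hpow (1 / 2) (by norm_num) (by norm_num) _ hsmall j).trans ?_
    gcongr
    exact norm_iterate_le_of_norm_le hle hzb k₀

/-! ### Schroeder's equation: correction and uniqueness at high order -/

/-- A continuous function vanishing to order `m` at the origin is bounded by a multiple of
`‖z‖ ^ m` on every smaller closed ball. -/
theorem exists_norm_le_mul_pow_of_isBigO {n : ℕ} {F : Type*} [NormedAddCommGroup F]
    {R : Cn n → F} (hR : ContinuousOn R (unitBall n)) {m : ℕ}
    (hO : R =O[𝓝 0] fun z => ‖z‖ ^ m) {r : ℝ} (hr : r < 1) :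
    ∃ C, 0 ≤ C ∧ ∀ z, ‖z‖ ≤ r → ‖R z‖ ≤ C * ‖z‖ ^ m := by
  obtain ⟨C₁, hC₁0, hC₁⟩ := hO.exists_pos
  rw [Asymptotics.isBigOWith_iff, Metric.eventually_nhds_iff_ball] at hC₁
  obtain ⟨δ, hδ, hC₁⟩ := hC₁
  obtain ⟨C₂, hC₂⟩ := (isCompact_closedBall (0 : Cn n) r).exists_bound_of_continuousOn
    (hR.mono (Metric.closedBall_subset_ball hr))
  refine ⟨C₁ + |C₂| / δ ^ m, by positivity, fun z hz => ?_⟩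
  rcases lt_or_ge ‖z‖ δ with h | h
  · have := hC₁ z (by simpa using h)
    rw [norm_pow, norm_norm] at this
    refine this.trans ?_
    gcongr
    have : 0 ≤ |C₂| / δ ^ m := by positivity
    linarith
  · have h1 := (hC₂ z (by simpa using hz)).trans (le_abs_self _)
    have h2 : |C₂| ≤ |C₂| / δ ^ m * ‖z‖ ^ m := by
      rw [div_mul_eq_mul_div, le_div_iff₀ (by positivity)]
      gcongr
    rw [add_mul]
    have : 0 ≤ C₁ * ‖z‖ ^ m := by positivity
    linarith

theorem AnalyticOnNhd.iterate_unitBall {n : ℕ} {φ : Cn n → Cn n}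
    (hφ : AnalyticOnNhd ℂ φ (unitBall n)) (hmaps : MapsTo φ (unitBall n) (unitBall n)) (k : ℕ) :
    AnalyticOnNhd ℂ φ^[k] (unitBall n) := by
  induction k with
  | zero => exact analyticOnNhd_id
  | succ k ih =>
    rw [Function.iterate_succ']
    exact hφ.comp ih (hmaps.iterate k)

theorem ContinuousLinearEquiv.norm_iterate_symm_le {E : Type*} [NormedAddCommGroup E]
    [NormedSpace ℂ E] (A : E ≃L[ℂ] E) (k : ℕ) (v : E) :
    ‖A.symm^[k] v‖ ≤ ‖(A.symm : E →L[ℂ] E)‖ ^ k * ‖v‖ := by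
  induction k with
  | zero => simp
  | succ k ih =>
    rw [Function.iterate_succ_apply', pow_succ', mul_assoc]
    exact ((A.symm : E →L[ℂ] E).le_opNorm _).trans (by gcongr)

/-- An approximate solution of Schroeder's equation, with an error of sufficiently high order at
the origin, can be corrected to an exact one. -/
theorem exists_schroeder_of_approx {n : ℕ} {φ : Cn n → Cn n}
    (hφ : AnalyticOnNhd ℂ φ (unitBall n)) (hmaps : MapsTo φ (unitBall n) (unitBall n))
    (A : Cn n ≃L[ℂ] Cn n) {α : ℝ} (hα : 0 < α)
    (horb : ∀ r < 1, ∃ K, 0 ≤ K ∧ ∀ z : Cn n, ‖z‖ ≤ r → ∀ k, ‖φ^[k] z‖ ≤ K * α ^ k * ‖z‖)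
    (hle : ∀ z ∈ unitBall n, ‖φ z‖ ≤ ‖z‖) {m : ℕ}
    (hm : ‖(A.symm : Cn n →L[ℂ] Cn n)‖ * α ^ m < 1) {P : Cn n → Cn n}
    (hP : AnalyticOnNhd ℂ P (unitBall n))
    (hR : (fun z => P (φ z) - A (P z)) =O[𝓝 0] fun z => ‖z‖ ^ m) :
    ∃ F : Cn n → Cn n, AnalyticOnNhd ℂ F (unitBall n) ∧
      (∀ z ∈ unitBall n, F (φ z) = A (F z)) ∧
      (fun z => F z - P z) =O[𝓝 0] fun z => ‖z‖ ^ m := by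
  set b := ‖(A.symm : Cn n →L[ℂ] Cn n)‖ with hb
  have hb0 : 0 ≤ b := norm_nonneg _
  set γ := b * α ^ m with hγ
  have hγ0 : 0 ≤ γ := by positivity
  set s : ℕ → Cn n → Cn n := fun k z => A.symm^[k] (P (φ^[k] z)) with hs
  have hRc : ContinuousOn (fun z => P (φ z) - A (P z)) (unitBall n) :=
    ((hP.comp hφ hmaps).continuousOn).sub (A.continuous.comp_continuousOn hP.continuousOn)
  -- Consecutive terms differ by A⁻⁽ᵏ⁺¹⁾ applied to the error at φᵏ(z), which is O(α^(mk)); hence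
  -- the ratio γ.
  have hstep : ∀ r < 1, ∃ C, 0 ≤ C ∧ ∀ z : Cn n, ‖z‖ ≤ r → ∀ k,
      dist (s k z) (s (k + 1) z) ≤ C * ‖z‖ ^ m * γ ^ k := by
    intro r hr
    obtain ⟨C, hC, hCR⟩ := exists_norm_le_mul_pow_of_isBigO hRc hR hr
    obtain ⟨K, hK, hKz⟩ := horb r hr
    refine ⟨b * C * K ^ m, by positivity, fun z hz k => ?_⟩
    have hzb : z ∈ unitBall n := by rw [mem_ball_zero_iff]; linarith
    have h1 : s (k + 1) z - s k z =
        A.symm^[k + 1] (P (φ (φ^[k] z)) - A (P (φ^[k] z))) := by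
      simp only [hs]
      rw [iterate_map_sub, Function.iterate_succ_apply' φ, Function.iterate_succ_apply _ k (A _),
        A.symm_apply_apply]
    rw [dist_comm, dist_eq_norm, h1]
    refine (A.norm_iterate_symm_le _ _).trans ?_
    calc b ^ (k + 1) * ‖P (φ (φ^[k] z)) - A (P (φ^[k] z))‖
        ≤ b ^ (k + 1) * (C * (K * α ^ k * ‖z‖) ^ m) := by
          gcongr
          refine (hCR _ ((norm_iterate_le_of_norm_le hle hzb k).trans hz)).trans ?_
          gcongr
          exact hKz z hz k
      _ = b * C * K ^ m * ‖z‖ ^ m * γ ^ k := by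
          rw [hγ, mul_pow, mul_pow, mul_pow, pow_succ, ← pow_mul, ← pow_mul, mul_comm m k]; ring
  have hlim : ∀ z ∈ unitBall n, ∃ l, Tendsto (fun k => s k z) atTop (𝓝 l) := by
    intro z hz
    obtain ⟨C, -, hC⟩ := hstep ‖z‖ (by simpa using hz)
    exact cauchySeq_tendsto_of_complete (cauchySeq_of_le_geometric γ _ hm (hC z le_rfl))
  choose! F hF using hlim
  have hdist : ∀ r < 1, ∃ C, 0 ≤ C ∧ ∀ z : Cn n, ‖z‖ ≤ r → ∀ k,
      dist (s k z) (F z) ≤ C * ‖z‖ ^ m * γ ^ k := by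
    intro r hr
    obtain ⟨C, hC0, hC⟩ := hstep r hr
    have h1γ : 0 < 1 - γ := by linarith
    refine ⟨C / (1 - γ), by positivity, fun z hz k => ?_⟩
    have hzb : z ∈ unitBall n := by rw [mem_ball_zero_iff]; linarith
    refine (dist_le_of_le_geometric_of_tendsto γ _ hm (hC z hz) (hF z hzb) k).trans (le_of_eq ?_)
    ring
  refine ⟨F, ?_, fun z hz => ?_, ?_⟩
  · refine TendstoLocallyUniformlyOn.analyticOnNhd_complex Metric.isOpen_ball (f := s)
      (fun k => ?_) ?_
    · have h1 := hP.comp (hφ.iterate_unitBall hmaps k) (hmaps.iterate k)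
      have h2 : ∀ k, AnalyticOnNhd ℂ (A.symm^[k]) univ := by
        intro k
        induction k with
        | zero => exact analyticOnNhd_id
        | succ k ih =>
          rw [Function.iterate_succ']
          exact ((A.symm : Cn n →L[ℂ] Cn n).analyticOnNhd univ).comp ih (mapsTo_univ _ _)
      exact (h2 k).comp h1 (mapsTo_univ _ _)
    · refine tendstoLocallyUniformlyOn_of_forall_exists_nhds fun x hx => ?_
      obtain ⟨r, hr1, hr2⟩ := exists_between (mem_ball_zero_iff.1 hx)
      refine ⟨Metric.ball 0 r, nhdsWithin_le_nhds (Metric.isOpen_ball.mem_nhds (by simpa using hr1)),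
        ?_⟩
      obtain ⟨C, hC0, hC⟩ := hdist r hr2
      have hr0 : 0 ≤ r := (norm_nonneg _).trans hr1.le
      rw [Metric.tendstoUniformlyOn_iff]
      intro ε hε
      have ht : Tendsto (fun k => C * r ^ m * γ ^ k) atTop (𝓝 0) := by
        simpa using (tendsto_pow_atTop_nhds_zero_of_lt_one hγ0 hm).const_mul (C * r ^ m)
      filter_upwards [ht.eventually_lt_const hε] with k hk z hz
      rw [mem_ball_zero_iff] at hz
      rw [dist_comm]
      refine ((hC z hz.le k).trans ?_).trans_lt hk
      gcongr
  · have h1 := hF (φ z) (hmaps hz)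
    have h2 : Tendsto (fun k => A (s (k + 1) z)) atTop (𝓝 (A (F z))) :=
      (A.continuous.tendsto _).comp ((hF z hz).comp (tendsto_add_atTop_nat 1))
    refine tendsto_nhds_unique h1 (h2.congr fun k => ?_)
    simp only [hs]
    rw [Function.iterate_succ_apply', A.apply_symm_apply, Function.iterate_succ_apply]
  -- The distance estimate at k = 0, where s 0 = P.
  · obtain ⟨C, -, hC⟩ := hdist (1 / 2) (by norm_num)
    refine Asymptotics.IsBigO.of_bound C ?_
    filter_upwards [Metric.ball_mem_nhds (0 : Cn n) (by norm_num : (0 : ℝ) < 1 / 2)] with z hz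
    have := hC z (by simpa using (mem_ball_zero_iff.1 hz).le) 0
    simpa [dist_eq_norm, hs, norm_sub_rev] using this

/-- A solution of Schroeder's equation vanishing to sufficiently high order vanishes. -/
theorem schroeder_eq_zero_of_isBigO {n : ℕ} {φ D : Cn n → Cn n}
    (hmaps : MapsTo φ (unitBall n) (unitBall n))
    (A : Cn n ≃L[ℂ] Cn n) {α : ℝ} (hα : 0 < α)
    (horb : ∀ r < 1, ∃ K, 0 ≤ K ∧ ∀ z : Cn n, ‖z‖ ≤ r → ∀ k, ‖φ^[k] z‖ ≤ K * α ^ k * ‖z‖)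
    (hle : ∀ z ∈ unitBall n, ‖φ z‖ ≤ ‖z‖) {m : ℕ}
    (hm : ‖(A.symm : Cn n →L[ℂ] Cn n)‖ * α ^ m < 1)
    (hDc : ContinuousOn D (unitBall n)) (hD : ∀ z ∈ unitBall n, D (φ z) = A (D z))
    (hO : D =O[𝓝 0] fun z => ‖z‖ ^ m) : ∀ z ∈ unitBall n, D z = 0 := by
  intro z hz
  have hz1 : ‖z‖ < 1 := by simpa using hz
  have hit : ∀ k, D z = A.symm^[k] (D (φ^[k] z)) := by
    intro k
    induction k with
    | zero => rfl
    | succ k ih =>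
      rw [Function.iterate_succ_apply' φ, hD _ (hmaps.iterate k hz), Function.iterate_succ_apply,
        A.symm_apply_apply, ← ih]
  obtain ⟨C, hC0, hC⟩ := exists_norm_le_mul_pow_of_isBigO hDc hO hz1
  obtain ⟨K, hK0, hK⟩ := horb ‖z‖ hz1
  set b := ‖(A.symm : Cn n →L[ℂ] Cn n)‖ with hb
  have hb0 : 0 ≤ b := norm_nonneg _
  have hbound : ∀ k, ‖D z‖ ≤ C * (K * ‖z‖) ^ m * (b * α ^ m) ^ k := by
    intro k
    rw [hit k]
    refine (A.norm_iterate_symm_le _ _).trans ?_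
    calc b ^ k * ‖D (φ^[k] z)‖ ≤ b ^ k * (C * (K * α ^ k * ‖z‖) ^ m) := by
          gcongr
          refine (hC _ (norm_iterate_le_of_norm_le hle hz k)).trans ?_
          gcongr
          exact hK z le_rfl k
      _ = _ := by
          rw [mul_pow, mul_pow, mul_pow, mul_pow, ← pow_mul, ← pow_mul, mul_comm m k]; ring
  have ht : Tendsto (fun k => C * (K * ‖z‖) ^ m * (b * α ^ m) ^ k) atTop (𝓝 0) := by
    simpa using (tendsto_pow_atTop_nhds_zero_of_lt_one (by positivity) hm).const_mul
      (C * (K * ‖z‖) ^ m)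
  exact norm_le_zero_iff.1 (ge_of_tendsto' ht hbound)

/-! ### Similarity of an endomorphism to its transpose -/

open Polynomial in
/-- The cyclic module `k[X] / (q)` carries a nondegenerate form for which multiplication by `X` is
self-adjoint: take the top coefficient of the product. -/
theorem exists_nondegenerate_form_quotient_span {k : Type*} [Field k] {q : k[X]} (hq : q ≠ 0) :
    ∃ B : (k[X] ⧸ k[X] ∙ q) →+ (k[X] ⧸ k[X] ∙ q) →+ k,
      (∀ (f : k[X]) x y, B (f • x) y = B x (f • y)) ∧ (∀ (a : k) x y, B ((C a : k[X]) • x) y = a * B x y) ∧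
        ∀ x, (∀ y, B x y = 0) → x = 0 := by
  set p : k[X] := q * C q.leadingCoeff⁻¹ with hp
  have hpm : p.Monic := monic_mul_leadingCoeff_inv hq
  have hspan : ∀ f : k[X], f ∈ (k[X] ∙ q) ↔ p ∣ f := by
    intro f
    rw [Submodule.mem_span_singleton]
    have hu : IsUnit (C q.leadingCoeff⁻¹ : k[X]) :=
      isUnit_C.2 (IsUnit.mk0 _ (inv_ne_zero (leadingCoeff_ne_zero.2 hq)))
    rw [hp, hu.mul_right_dvd]
    constructor
    · rintro ⟨a, rfl⟩; exact Dvd.intro_left a rfl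
    · rintro ⟨a, rfl⟩; exact ⟨a, by rw [smul_eq_mul, mul_comm]⟩
  let d := p.natDegree
  -- τ reads the coefficient of X^(d-1) in the remainder modulo p. If d = 0, the truncated d - 1 is
  -- harmless: p = 1 and all remainders vanish.
  let τ : k[X] →ₗ[k] k := (lcoeff k (d - 1)).comp (modByMonicHom p)
  have hτ : ∀ f, p ∣ f → τ f = 0 := by
    intro f hf
    simp [τ, (modByMonic_eq_zero_iff_dvd hpm).2 hf]
  let B₀ : k[X] → k[X] →+ k := fun f => τ.toAddMonoidHom.comp (AddMonoidHom.mulLeft f)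
  let B₁ : k[X] → (k[X] ⧸ k[X] ∙ q) →+ k := fun f =>
    QuotientAddGroup.lift _ (B₀ f) (by
      intro g hg
      exact hτ _ (Dvd.dvd.mul_left ((hspan g).1 hg) f))
  let B₂ : k[X] →+ (k[X] ⧸ k[X] ∙ q) →+ k :=
    { toFun := B₁
      map_zero' := by
        ext x
        obtain ⟨g, rfl⟩ := Submodule.Quotient.mk_surjective _ x
        change τ (0 * g) = 0
        simp
      map_add' := by
        intro f f'
        ext x
        obtain ⟨g, rfl⟩ := Submodule.Quotient.mk_surjective _ x
        change τ ((f + f') * g) = τ (f * g) + τ (f' * g)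
        rw [add_mul, map_add] }
  let B : (k[X] ⧸ k[X] ∙ q) →+ (k[X] ⧸ k[X] ∙ q) →+ k :=
    QuotientAddGroup.lift _ B₂ (by
      intro f hf
      ext x
      obtain ⟨g, rfl⟩ := Submodule.Quotient.mk_surjective _ x
      exact hτ _ (Dvd.dvd.mul_right ((hspan f).1 hf) g))
  have hB : ∀ f g : k[X], B (Submodule.Quotient.mk f) (Submodule.Quotient.mk g) = τ (f * g) :=
    fun f g => rfl
  refine ⟨B, ?_, ?_, ?_⟩
  · intro f x y
    obtain ⟨x, rfl⟩ := Submodule.Quotient.mk_surjective _ x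
    obtain ⟨y, rfl⟩ := Submodule.Quotient.mk_surjective _ y
    rw [← Submodule.Quotient.mk_smul, ← Submodule.Quotient.mk_smul, hB, hB]
    simp only [smul_eq_mul]
    ring_nf
  · intro a x y
    obtain ⟨x, rfl⟩ := Submodule.Quotient.mk_surjective _ x
    obtain ⟨y, rfl⟩ := Submodule.Quotient.mk_surjective _ y
    rw [← Submodule.Quotient.mk_smul, hB, hB, smul_eq_mul, mul_assoc, ← smul_eq_C_mul, map_smul,
      smul_eq_mul]
  · intro x hx
    obtain ⟨f, rfl⟩ := Submodule.Quotient.mk_surjective _ x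
    by_contra hne
    have hndvd : ¬ p ∣ f := fun h => hne ((Submodule.Quotient.mk_eq_zero _).2 ((hspan f).2 h))
    set g := f %ₘ p with hg
    have hg0 : g ≠ 0 := fun h => hndvd ((modByMonic_eq_zero_iff_dvd hpm).1 h)
    have hp1 : p ≠ 1 := by
      rintro h
      exact hndvd (h ▸ one_dvd f)
    have hdeg : g.natDegree < d := natDegree_modByMonic_lt f hpm hp1
    -- This power of X lifts the leading term of the remainder g to degree d - 1, so the product
    -- needs no reduction and τ returns the leading coefficient of g.
    have h1 := hx (Submodule.Quotient.mk (X ^ (d - 1 - g.natDegree)))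
    rw [hB] at h1
    have h2 : τ (f * X ^ (d - 1 - g.natDegree)) = τ (g * X ^ (d - 1 - g.natDegree)) := by
      rw [← sub_eq_zero, ← map_sub, ← sub_mul]
      refine hτ _ (Dvd.dvd.mul_right ?_ _)
      exact ⟨f /ₘ p, by linear_combination (-1 : k[X]) * modByMonic_add_div f p⟩
    have h3 : (g * X ^ (d - 1 - g.natDegree)) %ₘ p = g * X ^ (d - 1 - g.natDegree) := by
      rw [modByMonic_eq_self_iff hpm]
      apply degree_lt_degree
      rw [natDegree_mul_X_pow _ hg0]
      change _ < d
      omega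
    rw [h2] at h1
    have h4 : τ (g * X ^ (d - 1 - g.natDegree)) = g.leadingCoeff := by
      change ((g * X ^ (d - 1 - g.natDegree)) %ₘ p).coeff (d - 1) = _
      rw [h3]
      conv_lhs => rw [show d - 1 = g.natDegree + (d - 1 - g.natDegree) by omega]
      rw [show g.natDegree + (d - 1 - g.natDegree) - g.natDegree = d - 1 - g.natDegree by omega,
        coeff_mul_X_pow]
      rfl
    rw [h4] at h1
    exact hg0 (leadingCoeff_eq_zero.1 h1)

open Polynomial in
/-- Every endomorphism of a finite dimensional space is self-adjoint for some nondegenerate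
bilinear form (so that it is similar to its transpose). -/
theorem exists_injective_dual_intertwining {k V : Type*} [Field k] [AddCommGroup V] [Module k V]
    [FiniteDimensional k V] (T : Module.End k V) :
    ∃ B : V →ₗ[k] Module.Dual k V, Function.Injective B ∧ ∀ x y, B (T x) y = B x (T y) := by
  classical
  -- With X acting as T, V is a direct sum of cyclic modules k[X]/(pᵢ^eᵢ); the form sought is the
  -- orthogonal sum of the forms on the summands.
  obtain ⟨ι, _, p, hp, e, ⟨E⟩⟩ := Module.equiv_directSum_of_isTorsion
    (Module.AEval.isTorsion_of_finiteDimensional k V T)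
  choose β hβ1 hβ2 hβ3 using fun i =>
    exists_nondegenerate_form_quotient_span (pow_ne_zero (e i) (hp i).ne_zero)
  let E' : V →+ DirectSum ι fun i => k[X] ⧸ k[X] ∙ p i ^ e i :=
    E.toAddMonoidHom.comp (Module.AEval'.of T).toLinearMap.toAddMonoidHom
  have hE'T : ∀ x, E' (T x) = (X : k[X]) • E' x := by
    intro x
    change E (Module.AEval'.of T (T x)) = X • E (Module.AEval'.of T x)
    rw [← map_smul, Module.AEval'.X_smul_of]
  have hE'k : ∀ (a : k) x, E' (a • x) = (C a : k[X]) • E' x := by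
    intro a x
    change E (Module.AEval'.of T (a • x)) = C a • E (Module.AEval'.of T x)
    rw [← map_smul, Module.AEval'.of, Module.AEval.C_smul, map_smul]
  have hE'0 : ∀ x, E' x = 0 → x = 0 := by
    intro x hx
    have h1 : Module.AEval'.of T x = 0 := E.map_eq_zero_iff.1 hx
    exact (Module.AEval'.of T).map_eq_zero_iff.1 h1
  have hright : ∀ i a x y, β i x (C a • y) = a * β i x y := by
    intro i a x y
    rw [← hβ1, hβ2]
  let B : V →ₗ[k] Module.Dual k V := LinearMap.mk₂ k (fun x y => ∑ i, β i (E' x i) (E' y i))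
    (by intro x x' y
        simp only [map_add, DirectSum.add_apply, AddMonoidHom.add_apply, Finset.sum_add_distrib])
    (by intro a x y
        simp only [hE'k, DirectSum.smul_apply, hβ2, Finset.mul_sum, smul_eq_mul])
    (by intro x y y'
        simp only [map_add, DirectSum.add_apply, Finset.sum_add_distrib])
    (by intro a x y
        simp only [hE'k, DirectSum.smul_apply, hright, Finset.mul_sum, smul_eq_mul])
  have hB : ∀ x y, B x y = ∑ i, β i (E' x i) (E' y i) := fun x y => rfl
  refine ⟨B, ?_, ?_⟩
  · rw [injective_iff_map_eq_zero]
    intro x hx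
    apply hE'0
    ext i : 1
    refine hβ3 i _ fun y => ?_
    obtain ⟨v, hv⟩ : ∃ v, E' v = DirectSum.of (fun i => k[X] ⧸ k[X] ∙ p i ^ e i) i y := by
      obtain ⟨w, hw⟩ := E.surjective (DirectSum.of (fun i => k[X] ⧸ k[X] ∙ p i ^ e i) i y)
      obtain ⟨v, hv⟩ := (Module.AEval'.of T).surjective w
      exact ⟨v, by change E (Module.AEval'.of T v) = _; rw [hv, hw]⟩
    have h1 : B x v = 0 := by rw [hx]; rfl
    rw [hB, hv, Finset.sum_eq_single i] at h1
    · simpa using h1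
    · intro j _ hj
      rw [DirectSum.of_eq_of_ne _ _ _ hj, map_zero]
    · simp
  · intro x y
    simp only [hB, hE'T, DirectSum.smul_apply, hβ1]

/-- A quotient of an endomorphism of a finite dimensional space is also a restriction of it. -/
theorem exists_injective_intertwining_of_surjective {k V Q : Type*} [Field k] [AddCommGroup V]
    [Module k V] [FiniteDimensional k V] [AddCommGroup Q] [Module k Q] {T : Module.End k V}
    {T' : Module.End k Q} {π : V →ₗ[k] Q} (hπ : Function.Surjective π)
    (hT : ∀ x, π (T x) = T' (π x)) :
    ∃ S : Q →ₗ[k] V, Function.Injective S ∧ ∀ x, T (S x) = S (T' x) := by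
  have : FiniteDimensional k Q := Module.Finite.of_surjective π hπ
  obtain ⟨B, hB, hBT⟩ := exists_injective_dual_intertwining T
  obtain ⟨B', hB', hBT'⟩ := exists_injective_dual_intertwining T'
  let e : V ≃ₗ[k] Module.Dual k V :=
    LinearEquiv.ofInjectiveOfFinrankEq B hB (Subspace.dual_finrank_eq).symm
  have he : ∀ x, e x = B x := fun x => rfl
  -- The forms identify T and T' with their transposes, and the transpose of the surjection π is an
  -- injection of duals.
  refine ⟨e.symm.toLinearMap ∘ₗ π.dualMap ∘ₗ B', ?_, fun x => ?_⟩
  · exact e.symm.injective.comp ((LinearMap.dualMap_injective_of_surjective hπ).comp hB')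
  · apply e.injective
    ext y
    have h1 : ∀ q, e (e.symm (π.dualMap (B' q))) = π.dualMap (B' q) := fun q => e.apply_symm_apply _
    simp only [LinearMap.comp_apply, LinearEquiv.coe_coe]
    rw [h1, he, hBT, ← he, h1]
    simp [hT, hBT']

/-! ### Jets at the origin and approximate solutions -/

theorem apply_eq_sum_single {n : ℕ} (A : Cn n →L[ℂ] Cn n) (v : Cn n) (i : Fin n) :
    A v i = ∑ j, A (EuclideanSpace.single j 1) i * v j := by
  have hv : v = ∑ j, v j • (EuclideanSpace.single j 1 : Cn n) := by
    simpa using ((EuclideanSpace.basisFun (Fin n) ℂ).sum_repr v).symm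
  conv_lhs => rw [hv]
  simp [mul_comm]

/-- Analytic functions on the unit ball. -/
def analyticFunctions (n : ℕ) : Submodule ℂ (Cn n → ℂ) where
  carrier := {f | AnalyticOnNhd ℂ f (unitBall n)}
  zero_mem' := analyticOnNhd_const
  add_mem' := fun h₁ h₂ => h₁.add h₂
  smul_mem' := fun _ _ h => h.const_smul

/-- Functions vanishing to order `m` at the origin. -/
def vanishingFunctions (n m : ℕ) : Submodule ℂ (Cn n → ℂ) where
  carrier := {f | f =O[𝓝 0] fun z => ‖z‖ ^ m}
  zero_mem' := Asymptotics.isBigO_zero _ _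
  add_mem' := fun h₁ h₂ => h₁.add h₂
  smul_mem' := fun c _ h => h.const_smul_left c

/-- The polynomial with given homogeneous components of degree less than `m`. -/
noncomputable def polynomialOfMultilinear (n m : ℕ) :
    ((k : Fin m) → ContinuousMultilinearMap ℂ (fun _ : Fin k => Cn n) ℂ) →ₗ[ℂ] (Cn n → ℂ) where
  toFun p z := ∑ k, p k fun _ => z
  map_add' p q := by ext z; simp [Finset.sum_add_distrib]
  map_smul' c p := by ext z; simp [Finset.mul_sum]

theorem finiteDimensional_continuousMultilinearMap (n k : ℕ) :
    FiniteDimensional ℂ (ContinuousMultilinearMap ℂ (fun _ : Fin k => Cn n) ℂ) :=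
  FiniteDimensional.of_injective
    (ContinuousMultilinearMap.toMultilinearMapLinear : _ →ₗ[ℂ] _)
    ContinuousMultilinearMap.toMultilinearMap_injective

theorem analyticOnNhd_polynomialOfMultilinear {n m : ℕ}
    (p : (k : Fin m) → ContinuousMultilinearMap ℂ (fun _ : Fin k => Cn n) ℂ) :
    AnalyticOnNhd ℂ (polynomialOfMultilinear n m p) univ := by
  have : polynomialOfMultilinear n m p = fun z => ∑ k, p k fun _ => z := rfl
  rw [this]
  refine Finset.analyticOnNhd_fun_sum _ fun k _ z _ => ?_
  have h1 : AnalyticAt ℂ (p k) fun _ => z := (p k).analyticAt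
  have h2 : AnalyticAt ℂ (fun z : Cn n => (fun _ : Fin k => z)) z :=
    (ContinuousLinearMap.pi fun _ : Fin k => ContinuousLinearMap.id ℂ (Cn n)).analyticAt z
  exact h1.comp_of_eq h2 rfl

theorem exists_polynomial_sub_isBigO {n : ℕ} (m : ℕ) {f : Cn n → ℂ} (hf : AnalyticAt ℂ f 0) :
    ∃ p, (f - polynomialOfMultilinear n m p) =O[𝓝 0] fun z => ‖z‖ ^ m := by
  obtain ⟨p, hp⟩ := hf
  refine ⟨fun k => p k, ?_⟩
  refine (hp.isBigO_sub_partialSum_pow m).congr_left fun z => ?_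
  rw [zero_add, FormalMultilinearSeries.partialSum, ← Fin.sum_univ_eq_sum_range
    (fun k => p k fun _ => z)]
  rfl

/-- Composition with a self-map of the ball, on analytic functions modulo those vanishing to order
`m` at the origin. -/
theorem exists_comp_mapQ {n m : ℕ} {φ : Cn n → Cn n}
    (hφ : AnalyticOnNhd ℂ φ (unitBall n)) (hmaps : MapsTo φ (unitBall n) (unitBall n))
    (hle : ∀ z ∈ unitBall n, ‖φ z‖ ≤ ‖z‖) :
    ∃ T : Module.End ℂ (analyticFunctions n ⧸
        (vanishingFunctions n m).comap (analyticFunctions n).subtype),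
      ∀ f : analyticFunctions n, T (Submodule.Quotient.mk f) = Submodule.Quotient.mk
        ⟨(f : Cn n → ℂ) ∘ φ, AnalyticOnNhd.comp f.2 hφ hmaps⟩ := by
  let C : Module.End ℂ (analyticFunctions n) :=
    { toFun := fun f => ⟨(f : Cn n → ℂ) ∘ φ, AnalyticOnNhd.comp f.2 hφ hmaps⟩
      map_add' := fun f g => rfl
      map_smul' := fun c f => rfl }
  refine ⟨Submodule.mapQ _ _ C ?_, fun f => rfl⟩
  intro f hf
  change ((f : Cn n → ℂ) ∘ φ) =O[𝓝 0] fun z => ‖z‖ ^ m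
  have hf' : (f : Cn n → ℂ) =O[𝓝 0] fun z => ‖z‖ ^ m := hf
  have h0 : φ 0 = 0 := norm_le_zero_iff.1 (by simpa using hle 0 (by simp))
  have ht : Tendsto φ (𝓝 0) (𝓝 0) := by
    have := (hφ 0 (by simp)).continuousAt.tendsto
    rwa [h0] at this
  refine (hf'.comp_tendsto ht).trans ?_
  refine Asymptotics.IsBigO.of_bound 1 ?_
  filter_upwards [Metric.ball_mem_nhds (0 : Cn n) one_pos] with z hz
  simp only [Function.comp_apply, norm_pow, norm_norm, one_mul]
  gcongr
  exact hle z hz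

/-- Every class is represented by a Taylor polynomial of degree less than m. -/
theorem finiteDimensional_analytic_quotient_vanishing (n m : ℕ) :
    FiniteDimensional ℂ (analyticFunctions n ⧸
      (vanishingFunctions n m).comap (analyticFunctions n).subtype) := by
  let Λ : ((k : Fin m) → ContinuousMultilinearMap ℂ (fun _ : Fin k => Cn n) ℂ) →ₗ[ℂ]
      analyticFunctions n := (polynomialOfMultilinear n m).codRestrict _
        fun p => (analyticOnNhd_polynomialOfMultilinear p).mono (subset_univ _)
  have h := fun k : Fin m => finiteDimensional_continuousMultilinearMap n k
  refine Module.Finite.of_surjective ((Submodule.mkQ _).comp Λ) fun x => ?_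
  obtain ⟨f, rfl⟩ := Submodule.Quotient.mk_surjective _ x
  obtain ⟨p, hp⟩ := exists_polynomial_sub_isBigO m (f.2 0 (by simp))
  refine ⟨p, ((Submodule.Quotient.eq _).2 ?_).symm⟩
  exact hp

/-- The derivative at the origin, on analytic functions modulo those vanishing to order `m ≥ 2`. -/
theorem exists_fderiv_liftQ {n m : ℕ} (hm : 2 ≤ m) :
    ∃ π : (analyticFunctions n ⧸ (vanishingFunctions n m).comap (analyticFunctions n).subtype)
        →ₗ[ℂ] (Cn n →L[ℂ] ℂ),
      ∀ f : analyticFunctions n, π (Submodule.Quotient.mk f) = fderiv ℂ (f : Cn n → ℂ) 0 := by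
  have hd : ∀ f : analyticFunctions n, DifferentiableAt ℂ (f : Cn n → ℂ) 0 :=
    fun f => (f.2 0 (by simp)).differentiableAt
  let D : analyticFunctions n →ₗ[ℂ] (Cn n →L[ℂ] ℂ) :=
    { toFun := fun f => fderiv ℂ (f : Cn n → ℂ) 0
      map_add' := fun f g => fderiv_add (hd f) (hd g)
      map_smul' := fun c f => fderiv_const_smul (hd f) c }
  refine ⟨Submodule.liftQ _ D ?_, fun f => rfl⟩
  intro f hf
  have hf' : (f : Cn n → ℂ) =O[𝓝 0] fun z => ‖z‖ ^ m := hf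
  have h0 : (f : Cn n → ℂ) 0 = 0 := by
    simpa using hf'.eq_zero_imp.self_of_nhds (by simp; omega)
  have : HasFDerivAt (f : Cn n → ℂ) (0 : Cn n →L[ℂ] ℂ) 0 := by
    rw [hasFDerivAt_iff_isLittleO_nhds_zero]
    simp only [zero_add, h0, sub_zero, zero_apply]
    refine hf'.trans_isLittleO ?_
    exact (Asymptotics.isLittleO_norm_pow_id (by omega))
  exact this.fderiv

/-- Schroeder's equation can be solved up to an error of any given order, by a polynomial map
whose components are linearly independent up to that order. -/
theorem exists_approx_schroeder {n : ℕ} {φ : Cn n → Cn n}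
    (hφ : AnalyticOnNhd ℂ φ (unitBall n)) (hmaps : MapsTo φ (unitBall n) (unitBall n))
    (hle : ∀ z ∈ unitBall n, ‖φ z‖ ≤ ‖z‖) {m : ℕ} (hm : 2 ≤ m) :
    ∃ P : Cn n → Cn n, AnalyticOnNhd ℂ P univ ∧
      ((fun z => P (φ z) - fderiv ℂ φ 0 (P z)) =O[𝓝 0] fun z => ‖z‖ ^ m) ∧
      ∀ c : Fin n → ℂ, ((fun z => ∑ i, c i * P z i) =O[𝓝 0] fun z => ‖z‖ ^ m) → c = 0 := by
  classical
  have h0 : φ 0 = 0 := norm_le_zero_iff.1 (by simpa using hle 0 (by simp))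
  set A := fderiv ℂ φ 0 with hA
  obtain ⟨T, hT⟩ := exists_comp_mapQ (m := m) hφ hmaps hle
  obtain ⟨π, hπ⟩ := exists_fderiv_liftQ (n := n) hm
  have := finiteDimensional_analytic_quotient_vanishing n m
  let T' : Module.End ℂ (Cn n →L[ℂ] ℂ) :=
    { toFun := fun l => l.comp A
      map_add' := fun l l' => rfl
      map_smul' := fun c l => rfl }
  have hsurj : Function.Surjective π := fun l =>
    ⟨Submodule.Quotient.mk ⟨l, l.analyticOnNhd _⟩, by rw [hπ]; exact l.fderiv⟩
  have hint : ∀ x, π (T x) = T' (π x) := by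
    intro x
    obtain ⟨f, rfl⟩ := Submodule.Quotient.mk_surjective _ x
    rw [hT, hπ, hπ]
    have hf : DifferentiableAt ℂ (f : Cn n → ℂ) (φ 0) := by
      rw [h0]; exact (f.2 0 (by simp)).differentiableAt
    refine (fderiv_comp 0 hf (hφ 0 (by simp)).differentiableAt).trans ?_
    rw [h0]; rfl
  -- S embeds the dual of ℂⁿ in the jets equivariantly, but need not be a section of π. The images
  -- of the coordinate functionals are the components of P.
  obtain ⟨S, hS, hTS⟩ := exists_injective_intertwining_of_surjective hsurj hint
  have hex : ∀ i : Fin n, ∃ p, ∃ h : polynomialOfMultilinear n m p ∈ analyticFunctions n,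
      S (EuclideanSpace.proj i) = Submodule.Quotient.mk ⟨polynomialOfMultilinear n m p, h⟩ := by
    intro i
    obtain ⟨f, hf⟩ := Submodule.Quotient.mk_surjective _ (S (EuclideanSpace.proj i))
    obtain ⟨p, hp⟩ := exists_polynomial_sub_isBigO m (f.2 0 (by simp))
    refine ⟨p, (analyticOnNhd_polynomialOfMultilinear p).mono (subset_univ _), ?_⟩
    rw [← hf]
    exact (Submodule.Quotient.eq _).2 hp
  choose p hpa hp using hex
  set q : Fin n → Cn n → ℂ := fun i => polynomialOfMultilinear n m (p i) with hq
  have hqa : ∀ i, AnalyticOnNhd ℂ (q i) univ := fun i => analyticOnNhd_polynomialOfMultilinear _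
  have hsum : ∀ c : Fin n → ℂ, S (∑ i, c i • EuclideanSpace.proj i) =
      Submodule.Quotient.mk (∑ i, c i • (⟨q i, hpa i⟩ : analyticFunctions n)) := by
    intro c
    rw [map_sum, ← Submodule.mkQ_apply, map_sum]
    refine Finset.sum_congr rfl fun i _ => ?_
    rw [map_smul, map_smul, hp]
    rfl
  have hcoe : ∀ c : Fin n → ℂ, ((∑ i, c i • (⟨q i, hpa i⟩ : analyticFunctions n) :
      analyticFunctions n) : Cn n → ℂ) = fun z => ∑ i, c i * q i z := by
    intro c
    ext z
    simp
  refine ⟨fun z => WithLp.toLp 2 fun i => q i z, ?_, ?_, ?_⟩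
  · have h1 : AnalyticOnNhd ℂ (fun z => fun i => q i z) univ := fun z hz =>
      analyticAt_pi_iff.2 fun i => hqa i z hz
    exact ((PiLp.continuousLinearEquiv 2 ℂ (fun _ : Fin n => ℂ)).symm :
      (Fin n → ℂ) →L[ℂ] Cn n).analyticOnNhd univ |>.comp h1 (mapsTo_univ _ _)
  · have hcomp : ∀ i, (fun z => q i (φ z) - ∑ j, A (EuclideanSpace.single j 1) i * q j z) =O[𝓝 0]
        fun z => ‖z‖ ^ m := by
      intro i
      -- Composing the i-th coordinate with A gives the i-th row of A, so equivariance of S is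
      -- Schroeder's equation, read componentwise modulo order m.
      have h1 : T' (EuclideanSpace.proj i) =
          ∑ j, A (EuclideanSpace.single j 1) i • (EuclideanSpace.proj j : Cn n →L[ℂ] ℂ) := by
        ext v
        change (A v) i = _
        rw [apply_eq_sum_single A]
        simp
      have h2 := hTS (EuclideanSpace.proj i)
      rw [hp, hT, h1, hsum, Submodule.Quotient.eq] at h2
      have h3 : (((⟨q i ∘ φ, AnalyticOnNhd.comp (hpa i) hφ hmaps⟩ : analyticFunctions n) -
        ∑ j, A (EuclideanSpace.single j 1) i • (⟨q j, hpa j⟩ : analyticFunctions n) :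
          analyticFunctions n) : Cn n → ℂ) =O[𝓝 0] fun z => ‖z‖ ^ m := h2
      rw [Submodule.coe_sub, hcoe] at h3
      exact h3
    have h4 : (fun z => (fun i => q i (φ z) -
        ∑ j, A (EuclideanSpace.single j 1) i * q j z : Fin n → ℂ)) =O[𝓝 0] fun z => ‖z‖ ^ m :=
      Asymptotics.isBigO_pi.2 hcomp
    have h5 := (((PiLp.continuousLinearEquiv 2 ℂ (fun _ : Fin n => ℂ)).symm :
      (Fin n → ℂ) →L[ℂ] Cn n).isBigO_comp _ (𝓝 0)).trans h4
    refine h5.congr_left fun z => ?_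
    ext i
    change _ = q i (φ z) - A (WithLp.toLp 2 fun i => q i z) i
    rw [apply_eq_sum_single A]
    rfl
  · intro c hc
    have h1 : S (∑ i, c i • EuclideanSpace.proj i) = 0 := by
      rw [hsum, Submodule.Quotient.mk_eq_zero]
      change ((_ : analyticFunctions n) : Cn n → ℂ) =O[𝓝 0] fun z => ‖z‖ ^ m
      rw [hcoe]
      exact hc
    have h2 := (injective_iff_map_eq_zero S).1 hS _ h1
    ext i
    simpa using congrArg (fun l : Cn n →L[ℂ] ℂ => l (EuclideanSpace.single i 1)) h2

/-! ### Weighted Bergman spaces and point evaluations -/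

/-- A positive density leaves the null sets of Lebesgue measure on the ball unchanged. -/
theorem ae_unitBall_eq_iff {n : ℕ} {G : Cn n → ℝ} (hGc : ContinuousOn G (unitBall n))
    (hG : ∀ z ∈ unitBall n, 0 < G z) {p : Cn n → Prop} :
    (∀ᵐ z ∂weightMeasure G, p z) ↔ ∀ᵐ z ∂volume.restrict (unitBall n), p z := by
  have hm : AEMeasurable (fun z => ENNReal.ofReal (G z)) (volume.restrict (unitBall n)) :=
    (hGc.aemeasurable measurableSet_ball).ennreal_ofReal
  rw [weightMeasure, ae_withDensity_iff' hm]
  refine eventually_congr ?_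
  filter_upwards [ae_restrict_mem measurableSet_ball] with z hz
  simp [hG z hz]

/-- Continuous functions on the ball which agree almost everywhere agree. -/
theorem eqOn_unitBall_of_ae_eq {n : ℕ} {G : Cn n → ℝ} (hGc : ContinuousOn G (unitBall n))
    (hG : ∀ z ∈ unitBall n, 0 < G z) {f g : Cn n → ℂ} (hf : ContinuousOn f (unitBall n))
    (hg : ContinuousOn g (unitBall n)) (h : f =ᵐ[weightMeasure G] g) :
    EqOn f g (unitBall n) :=
  Measure.eqOn_open_of_ae_eq ((ae_unitBall_eq_iff hGc hG).1 h) Metric.isOpen_ball hf hg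

theorem ae_eq_of_eqOn_unitBall {n : ℕ} {G : Cn n → ℝ} (hGc : ContinuousOn G (unitBall n))
    (hG : ∀ z ∈ unitBall n, 0 < G z) {f g : Cn n → ℂ} (h : EqOn f g (unitBall n)) :
    f =ᵐ[weightMeasure G] g :=
  (ae_unitBall_eq_iff hGc hG).2 ((ae_restrict_mem measurableSet_ball).mono fun _ hz => h hz)

theorem aestronglyMeasurable_weightMeasure {n : ℕ} {G : Cn n → ℝ} {f : Cn n → ℂ}
    (hf : ContinuousOn f (unitBall n)) : AEStronglyMeasurable f (weightMeasure G) :=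
  (hf.aestronglyMeasurable measurableSet_ball).mono_ac (withDensity_absolutelyContinuous _ _)

theorem integrable_weightMeasure_iff {n : ℕ} {G : Cn n → ℝ} (hGc : ContinuousOn G (unitBall n))
    (hG : ∀ z ∈ unitBall n, 0 < G z) {u : Cn n → ℝ} :
    Integrable u (weightMeasure G) ↔ IntegrableOn (fun z => G z * u z) (unitBall n) := by
  have hm : AEMeasurable (fun z => ENNReal.ofReal (G z)) (volume.restrict (unitBall n)) :=
    (hGc.aemeasurable measurableSet_ball).ennreal_ofReal
  rw [weightMeasure, integrable_withDensity_iff_integrable_smul₀' hm (by simp)]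
  refine integrable_congr ?_
  filter_upwards [ae_restrict_mem measurableSet_ball] with z hz
  rw [ENNReal.toReal_ofReal (hG z hz).le, smul_eq_mul]

theorem integral_weightMeasure {n : ℕ} {G : Cn n → ℝ} (hGc : ContinuousOn G (unitBall n))
    (hG : ∀ z ∈ unitBall n, 0 < G z) (u : Cn n → ℝ) :
    ∫ z, u z ∂weightMeasure G = ∫ z in unitBall n, G z * u z := by
  have hm : AEMeasurable (fun z => ENNReal.ofReal (G z)) (volume.restrict (unitBall n)) :=
    (hGc.aemeasurable measurableSet_ball).ennreal_ofReal
  rw [weightMeasure, integral_withDensity_eq_integral_toReal_smul₀ hm (by simp)]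
  refine integral_congr_ae ?_
  filter_upwards [ae_restrict_mem measurableSet_ball] with z hz
  simp only [ENNReal.toReal_ofReal (hG z hz).le, smul_eq_mul]

theorem memLp_weightMeasure_of_le {n : ℕ} {G : Cn n → ℝ} (hGc : ContinuousOn G (unitBall n))
    (hG : ∀ z ∈ unitBall n, 0 < G z) {f : Cn n → ℂ} (hf : ContinuousOn f (unitBall n))
    {u : Cn n → ℝ} (hu : IntegrableOn u (unitBall n))
    (hle : ∀ z ∈ unitBall n, G z * ‖f z‖ ^ 2 ≤ u z) : MemLp f 2 (weightMeasure G) := by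
  rw [memLp_two_iff_integrable_sq_norm (aestronglyMeasurable_weightMeasure hf),
    integrable_weightMeasure_iff hGc hG]
  refine hu.mono' ((hGc.mul (hf.norm.pow 2)).aestronglyMeasurable measurableSet_ball) ?_
  filter_upwards [ae_restrict_mem measurableSet_ball] with z hz
  rw [Real.norm_of_nonneg (mul_nonneg (hG z hz).le (by positivity))]
  exact hle z hz

/-- Multiplication by a complex number of modulus one, as an isometry of `ℂⁿ`. -/
noncomputable def rotationIsometry {n : ℕ} (c : ℂ) (hc : ‖c‖ = 1) : Cn n ≃ₗᵢ[ℝ] Cn n where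
  toFun z := c • z
  invFun z := c⁻¹ • z
  map_add' := smul_add c
  map_smul' a z := smul_comm c a z
  left_inv z := inv_smul_smul₀ (norm_ne_zero_iff.1 (by rw [hc]; exact one_ne_zero)) z
  right_inv z := smul_inv_smul₀ (norm_ne_zero_iff.1 (by rw [hc]; exact one_ne_zero)) z
  norm_map' z := by
    change ‖c • z‖ = ‖z‖
    rw [norm_smul, hc, one_mul]

/-- The mean value property over balls centred at the origin. -/
theorem setIntegral_ball_zero_of_analyticOnNhd {n : ℕ} {f : Cn n → ℂ} {ρ : ℝ}
    (hf : AnalyticOnNhd ℂ f (Metric.closedBall 0 ρ)) :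
    ∫ z in Metric.ball 0 ρ, f z = (volume.real (Metric.ball (0 : Cn n) ρ) : ℂ) * f 0 := by
  -- The ball is invariant under z ↦ e^{iθ}z. Averaging over θ, exchanging the integrals and using
  -- the mean value property on each disc through z reduces the claim to one variable.
  have hrot : ∀ θ : ℝ, ∫ z in Metric.ball (0 : Cn n) ρ, f (circleMap 0 1 θ • z) =
      ∫ z in Metric.ball (0 : Cn n) ρ, f z := by
    intro θ
    have hc : ‖circleMap 0 1 θ‖ = 1 := by simp
    have hpre : (rotationIsometry (n := n) _ hc) ⁻¹' Metric.ball 0 ρ = Metric.ball 0 ρ := by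
      ext z
      change circleMap 0 1 θ • z ∈ Metric.ball (0 : Cn n) ρ ↔ _
      rw [mem_ball_zero_iff, mem_ball_zero_iff, norm_smul, hc, one_mul]
    have h1 := (rotationIsometry (n := n) _ hc).measurePreserving.setIntegral_preimage_emb
      (rotationIsometry (n := n) _ hc).toHomeomorph.measurableEmbedding f (Metric.ball 0 ρ)
    rw [hpre] at h1
    exact h1
  have hmean : ∀ z ∈ Metric.ball (0 : Cn n) ρ,
      ∫ θ in Ioc (0 : ℝ) (2 * Real.pi), f (circleMap 0 1 θ • z) = (2 * Real.pi : ℝ) * f 0 := by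
    intro z hz
    have hd : DifferentiableOn ℂ (fun t : ℂ => f (t • z)) (Metric.closedBall 0 1) := by
      refine hf.differentiableOn.comp (by fun_prop) fun t ht => ?_
      rw [mem_closedBall_zero_iff] at ht ⊢
      rw [mem_ball_zero_iff] at hz
      rw [norm_smul]
      exact (mul_le_of_le_one_left (norm_nonneg _) ht).trans hz.le
    have h1 : Real.circleAverage (fun t : ℂ => f (t • z)) 0 1 = f ((0 : ℂ) • z) := by
      refine DiffContOnCl.circleAverage (f := fun t : ℂ => f (t • z)) ?_
      refine DifferentiableOn.diffContOnCl ?_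
      rw [abs_one, closure_ball _ one_ne_zero]
      exact hd
    rw [Real.circleAverage, intervalIntegral.integral_of_le (by positivity), zero_smul] at h1
    rw [← h1, Complex.real_smul, ← mul_assoc, ← Complex.ofReal_mul,
      mul_inv_cancel₀ (by positivity)]
    simp
  have hint : Integrable (Function.uncurry fun (θ : ℝ) (z : Cn n) => f (circleMap 0 1 θ • z))
      ((volume.restrict (Ioc (0 : ℝ) (2 * Real.pi))).prod
        (volume.restrict (Metric.ball (0 : Cn n) ρ))) := by
    rw [Measure.prod_restrict]
    have hcont : ContinuousOn (Function.uncurry fun (θ : ℝ) (z : Cn n) => f (circleMap 0 1 θ • z))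
        (Icc (0 : ℝ) (2 * Real.pi) ×ˢ Metric.closedBall (0 : Cn n) ρ) := by
      refine hf.continuousOn.comp (f := fun p : ℝ × Cn n => circleMap 0 1 p.1 • p.2) ?_ ?_
      · exact (((continuous_circleMap 0 1).comp continuous_fst).smul continuous_snd).continuousOn
      · rintro ⟨θ, z⟩ ⟨-, hz⟩
        rw [mem_closedBall_zero_iff] at hz ⊢
        simpa [norm_smul] using hz
    exact (hcont.integrableOn_compact (isCompact_Icc.prod (isCompact_closedBall _ _))).mono_set
      (prod_mono Ioc_subset_Icc_self Metric.ball_subset_closedBall)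
  have hswap := integral_integral_swap hint
  simp_rw [hrot] at hswap
  rw [setIntegral_congr_fun measurableSet_ball hmean] at hswap
  simp only [integral_const, measureReal_restrict_apply_univ, Real.volume_real_Ioc_of_le
    (by positivity : (0 : ℝ) ≤ 2 * Real.pi), sub_zero, Complex.real_smul] at hswap
  have hpi : ((2 * Real.pi : ℝ) : ℂ) ≠ 0 := by exact_mod_cast (by positivity : 2 * Real.pi ≠ 0)
  apply mul_left_cancel₀ hpi
  rw [hswap]
  ring

/-- The mean value property for the analytic function f², translated to w, takes the place of
subharmonicity of |f|². -/
theorem norm_sq_le_setIntegral_ball {n : ℕ} {f : Cn n → ℂ} {w : Cn n} {ρ : ℝ}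
    (hf : AnalyticOnNhd ℂ f (Metric.closedBall w ρ)) :
    volume.real (Metric.ball (0 : Cn n) ρ) * ‖f w‖ ^ 2 ≤ ∫ z in Metric.ball w ρ, ‖f z‖ ^ 2 := by
  have hF : AnalyticOnNhd ℂ (fun z => f (w + z) ^ 2) (Metric.closedBall 0 ρ) := by
    intro z hz
    have h1 : AnalyticAt ℂ f (w + z) := hf _ (by simpa [dist_eq_norm] using hz)
    have h2 : AnalyticAt ℂ (fun z : Cn n => w + z) z := analyticAt_const.add analyticAt_id
    exact (AnalyticAt.fun_comp h1 h2).pow 2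
  have h1 := setIntegral_ball_zero_of_analyticOnNhd hF
  have h2 : volume.real (Metric.ball (0 : Cn n) ρ) * ‖f w‖ ^ 2 =
      ‖∫ z in Metric.ball 0 ρ, f (w + z) ^ 2‖ := by
    rw [h1, norm_mul, add_zero, norm_pow, Complex.norm_real, Real.norm_of_nonneg measureReal_nonneg]
  rw [h2]
  refine (norm_integral_le_integral_norm _).trans (le_of_eq ?_)
  have h3 := (measurePreserving_add_left (volume : Measure (Cn n)) w).setIntegral_preimage_emb
    (Homeomorph.addLeft w).measurableEmbedding (fun z => ‖f z‖ ^ 2) (Metric.ball w ρ)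
  have hpre : (fun z => w + z) ⁻¹' Metric.ball w ρ = Metric.ball 0 ρ := by
    ext z
    simp [dist_eq_norm]
  rw [hpre] at h3
  rw [← h3]
  simp [norm_pow]

theorem Lp_norm_sq_eq_integral {Ω : Type*} [MeasurableSpace Ω] {μ : Measure Ω} (f : Lp ℂ 2 μ) :
    ‖f‖ ^ 2 = ∫ x, ‖f x‖ ^ 2 ∂μ := by
  have h1 : (inner ℂ f f : ℂ) = ((∫ x, ‖f x‖ ^ 2 ∂μ : ℝ) : ℂ) := by
    rw [L2.inner_def, ← integral_complex_ofReal]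
    simp [inner_self_eq_norm_sq_to_K]
  rw [inner_self_eq_norm_sq_to_K, ← RCLike.ofReal_pow] at h1
  exact Complex.ofReal_injective h1

/-- Point evaluations are bounded on weighted Bergman spaces, uniformly on compact subsets of the
ball. -/
theorem exists_norm_le_mul_Lp_norm {n : ℕ} {G : Cn n → ℝ} (hGc : ContinuousOn G (unitBall n))
    (hG : ∀ z ∈ unitBall n, 0 < G z) {r : ℝ} (hr0 : 0 ≤ r) (hr : r < 1) :
    ∃ C, 0 ≤ C ∧ ∀ (f : Lp ℂ 2 (weightMeasure G)) (g : Cn n → ℂ),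
      AnalyticOnNhd ℂ g (unitBall n) → f =ᵐ[weightMeasure G] g →
        ∀ w, ‖w‖ ≤ r → ‖g w‖ ≤ C * ‖f‖ := by
  set ρ := (1 - r) / 2 with hρ
  have hρ0 : 0 < ρ := by rw [hρ]; linarith
  have hsub : Metric.closedBall (0 : Cn n) (r + ρ) ⊆ unitBall n :=
    Metric.closedBall_subset_ball (by rw [hρ]; linarith)
  -- All balls of radius ρ centred at points with |w| ≤ r lie in one compact ball, where G has a
  -- positive minimum; there the unweighted integral is controlled by the weighted one.
  obtain ⟨z₀, hz₀, hmin⟩ := (isCompact_closedBall (0 : Cn n) (r + ρ)).exists_isMinOn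
    ⟨0, by simp; positivity⟩ (hGc.mono hsub)
  have hδ : 0 < G z₀ := hG _ (hsub hz₀)
  set V := volume.real (Metric.ball (0 : Cn n) ρ) with hV
  have hV0 : 0 < V := ENNReal.toReal_pos (Metric.measure_ball_pos _ _ hρ0).ne'
    measure_ball_lt_top.ne
  refine ⟨√((V * G z₀)⁻¹), Real.sqrt_nonneg _, fun f g hg hfg w hw => ?_⟩
  have hwsub : Metric.closedBall w ρ ⊆ Metric.closedBall 0 (r + ρ) :=
    Metric.closedBall_subset_closedBall' (by rw [dist_zero_right]; linarith)
  have h1 := norm_sq_le_setIntegral_ball (hg.mono (hwsub.trans hsub))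
  have hmem : MemLp g 2 (weightMeasure G) := (memLp_congr_ae hfg).1 (Lp.memLp f)
  have hint : IntegrableOn (fun z => G z * ‖g z‖ ^ 2) (unitBall n) :=
    (integrable_weightMeasure_iff hGc hG).1 ((memLp_two_iff_integrable_sq_norm hmem.1).1 hmem)
  have hnorm : ∫ z in unitBall n, G z * ‖g z‖ ^ 2 = ‖f‖ ^ 2 := by
    rw [← integral_weightMeasure hGc hG, Lp_norm_sq_eq_integral]
    refine integral_congr_ae ?_
    filter_upwards [hfg] with z hz
    rw [hz]
  have hbw : Metric.ball w ρ ⊆ unitBall n :=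
    Metric.ball_subset_closedBall.trans (hwsub.trans hsub)
  have h2 : G z₀ * ∫ z in Metric.ball w ρ, ‖g z‖ ^ 2 ≤ ∫ z in Metric.ball w ρ, G z * ‖g z‖ ^ 2 := by
    rw [← integral_const_mul]
    refine setIntegral_mono_on ?_ (hint.mono_set hbw) measurableSet_ball fun z hz => ?_
    · refine Integrable.const_mul ?_ _
      exact (((hg.continuousOn.mono (hwsub.trans hsub)).norm.pow 2).integrableOn_compact
        (isCompact_closedBall _ _)).mono_set Metric.ball_subset_closedBall
    · gcongr
      exact hmin (hwsub (Metric.ball_subset_closedBall hz))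
  have h3 : ∫ z in Metric.ball w ρ, G z * ‖g z‖ ^ 2 ≤ ∫ z in unitBall n, G z * ‖g z‖ ^ 2 := by
    refine setIntegral_mono_set hint ?_ hbw.eventuallyLE
    filter_upwards [ae_restrict_mem measurableSet_ball] with z hz
    exact mul_nonneg (hG z hz).le (by positivity)
  have h4 : ‖g w‖ ^ 2 ≤ (V * G z₀)⁻¹ * ‖f‖ ^ 2 := by
    rw [inv_mul_eq_div, le_div_iff₀ (by positivity)]
    nlinarith
  refine (sq_le_sq₀ (norm_nonneg _) (by positivity)).1 ?_
  rw [mul_pow, Real.sq_sqrt (by positivity)]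
  exact h4

/-- A relation in L² holds everywhere on the ball by continuity, so the combination vanishes to
every order at 0, and `hind` applies. -/
theorem componentsLinearIndependent_of_memLp {n m : ℕ} {G : Cn n → ℝ}
    (hGc : ContinuousOn G (unitBall n)) (hG : ∀ z ∈ unitBall n, 0 < G z) {F : Cn n → Cn n}
    (hF : AnalyticOnNhd ℂ F (unitBall n))
    (hind : ∀ c : Fin n → ℂ, ((fun z => ∑ i, c i * F z i) =O[𝓝 0] fun z => ‖z‖ ^ m) → c = 0)
    (hmem : ∀ i, MemLp (fun z => F z i) 2 (weightMeasure G)) :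
    ComponentsLinearIndependent F G := by
  have hFi : ∀ i, AnalyticOnNhd ℂ (fun z => F z i) (unitBall n) := fun i =>
    ((EuclideanSpace.proj i : Cn n →L[ℂ] ℂ).analyticOnNhd univ).comp hF (mapsTo_univ _ _)
  refine ⟨fun i => ⟨(hmem i).toLp, fun z => F z i, hFi i, (hmem i).coeFn_toLp⟩,
    fun i => (hmem i).coeFn_toLp, ?_⟩
  rw [Fintype.linearIndependent_iff]
  intro c hc
  have h1 : ∑ i, c i • (hmem i).toLp = 0 := by
    simpa using congrArg (Subtype.val : bergmanSpace G → _) hc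
  have h2 : (fun z => ∑ i, c i * F z i) =ᵐ[weightMeasure G] fun _ => 0 := by
    have h3 := Lp.coeFn_finsetSum Finset.univ fun i => c i • (hmem i).toLp
    rw [h1] at h3
    have h4 : ∀ᵐ z ∂weightMeasure G, ∀ i,
        (c i • (hmem i).toLp : Lp ℂ 2 (weightMeasure G)) z = c i * F z i := by
      refine ae_all_iff.2 fun i => ?_
      filter_upwards [Lp.coeFn_smul (c i) (hmem i).toLp, (hmem i).coeFn_toLp] with z hz1 hz2
      rw [hz1, Pi.smul_apply, hz2, smul_eq_mul]
    filter_upwards [h3, h4, Lp.coeFn_zero ℂ 2 (weightMeasure G)] with z hz3 hz4 hz5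
    rw [hz5, Finset.sum_apply] at hz3
    simp only [hz4] at hz3
    exact hz3.symm
  have h5 := eqOn_unitBall_of_ae_eq hGc hG
    (continuousOn_finsetSum _ fun i _ => continuousOn_const.mul (hFi i).continuousOn)
    continuousOn_const h2
  refine congrFun (hind c ?_)
  refine (Asymptotics.isBigO_zero _ _).congr' ?_ EventuallyEq.rfl
  filter_upwards [Metric.ball_mem_nhds (0 : Cn n) one_pos] with z hz using (h5 hz).symm

/-! ### Rapidly decreasing weights -/

/-- The pointwise growth estimate for solutions of Schroeder's equation against a rapidly
decreasing weight. -/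
theorem exists_weight_mul_norm_sq_le {n : ℕ} (hn : n ≠ 0) {φ : Cn n → Cn n}
    (hmaps : MapsTo φ (unitBall n) (unitBall n)) {c : ℝ} (hc : 0 < c)
    (hφc : ∀ z ∈ unitBall n, ‖φ z‖ ≤ ‖z‖ * (1 - c * (1 - ‖z‖)))
    {α : ℝ} (hα : 0 < α) (hα1 : α < 1)
    (horb : ∀ r < 1, ∃ K, 0 ≤ K ∧ ∀ z : Cn n, ‖z‖ ≤ r → ∀ k, ‖φ^[k] z‖ ≤ K * α ^ k * ‖z‖)
    (A : Cn n ≃L[ℂ] Cn n) {F : Cn n → Cn n} (hF : ContinuousOn F (unitBall n))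
    (hFA : ∀ z ∈ unitBall n, F (φ z) = A (F z)) {g : ℝ → ℝ} (hg : RapidlyDecreasingWeight n g)
    (hgc : ContinuousOn (fun z : Cn n => g ‖z‖) (unitBall n)) :
    ∃ M, ∀ z ∈ unitBall n, g ‖z‖ * ‖F z‖ ^ 2 ≤ M := by
  set b := ‖(A.symm : Cn n →L[ℂ] Cn n)‖ with hb
  have hb0 : 0 ≤ b := norm_nonneg _
  -- For |z| ≥ 1/2 the Schwarz-Pick bound gives |φ(z)| ≤ 1 - (1 + c/2)(1 - |z|); half of c is given
  -- up to the factor |z|.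
  obtain ⟨C, hC⟩ := hg.bounded (1 + c / 2) (by linarith)
  have hsmall : ∀ᶠ r in 𝓝[<] (1 : ℝ), |C| * (1 - r) ^ (2 * n) * b ^ 2 < 1 := by
    have ht : Tendsto (fun r : ℝ => |C| * (1 - r) ^ (2 * n) * b ^ 2) (𝓝 1) (𝓝 0) := by
      have : Continuous fun r : ℝ => |C| * (1 - r) ^ (2 * n) * b ^ 2 := by fun_prop
      simpa [hn] using this.tendsto 1
    exact (ht.mono_left nhdsWithin_le_nhds).eventually_lt_const one_pos
  have hpos : ∀ᶠ r in 𝓝[<] (1 : ℝ), 0 < 1 - (1 + c / 2) * (1 - r) := by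
    have ht : Tendsto (fun r : ℝ => 1 - (1 + c / 2) * (1 - r)) (𝓝 1) (𝓝 1) := by
      have : Continuous fun r : ℝ => 1 - (1 + c / 2) * (1 - r) := by fun_prop
      simpa using this.tendsto 1
    exact (ht.mono_left nhdsWithin_le_nhds).eventually_const_lt one_pos
  obtain ⟨r₀, hr₀, hr₀'⟩ := (mem_nhdsLT_iff_exists_Ioo_subset).1 ((hC.and hsmall).and hpos)
  set r₁ := max r₀ (1 / 2) with hr₁
  have hr₁1 : r₁ < 1 := max_lt hr₀ (by norm_num)
  have hr₁0 : 0 < r₁ := lt_of_lt_of_le (by norm_num) (le_max_right _ _)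
  -- Pulling F back from φ(z) costs b², while the weight gains |C|(1 - |z|)^(2n). Near the boundary
  -- the product of the two is below 1.
  have hstep : ∀ z ∈ unitBall n, r₁ < ‖z‖ →
      g ‖z‖ * ‖F z‖ ^ 2 ≤ g ‖φ z‖ * ‖F (φ z)‖ ^ 2 := by
    intro z hz hrz
    have hz1 : ‖z‖ < 1 := by simpa using hz
    have hhalf : 1 / 2 ≤ ‖z‖ := (le_max_right _ _).trans hrz.le
    obtain ⟨⟨h1, h2⟩, h3⟩ := hr₀' ⟨(le_max_left _ _).trans_lt hrz, hz1⟩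
    set s := 1 - (1 + c / 2) * (1 - ‖z‖) with hs
    have hs1 : s < 1 := by rw [hs]; nlinarith
    have hφs : ‖φ z‖ ≤ s := by
      refine (hφc z hz).trans ?_
      rw [hs]
      nlinarith [mul_nonneg (mul_nonneg hc.le (sub_nonneg.2 hz1.le)) (sub_nonneg.2 hhalf)]
    have hgs : 0 < g s := hg.pos s ⟨h3.le, hs1⟩
    have hanti : g s ≤ g ‖φ z‖ := hg.antitoneOn
      ⟨norm_nonneg _, hφs.trans_lt hs1⟩ ⟨h3.le, hs1⟩ hφs
    have hgz : g ‖z‖ ≤ |C| * ((1 - ‖z‖) ^ (2 * n) * g s) := by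
      have hp : 0 < 1 - ‖z‖ := by linarith
      rw [← div_le_iff₀ (by positivity)]
      exact h1.trans (le_abs_self C)
    have hFz : ‖F z‖ ≤ b * ‖F (φ z)‖ := by
      have := (A.symm : Cn n →L[ℂ] Cn n).le_opNorm (F (φ z))
      rw [hFA z hz] at this ⊢
      simpa using this
    have hp : 0 ≤ 1 - ‖z‖ := by linarith
    have hgφ : 0 ≤ g ‖φ z‖ := hgs.le.trans hanti
    calc g ‖z‖ * ‖F z‖ ^ 2
        ≤ (|C| * ((1 - ‖z‖) ^ (2 * n) * g ‖φ z‖)) * (b * ‖F (φ z)‖) ^ 2 := by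
          gcongr
          exact hgz.trans (by gcongr)
      _ = (|C| * (1 - ‖z‖) ^ (2 * n) * b ^ 2) * (g ‖φ z‖ * ‖F (φ z)‖ ^ 2) := by ring
      _ ≤ _ := mul_le_of_le_one_left (by positivity) h2.le
  obtain ⟨M, hM⟩ := (isCompact_closedBall (0 : Cn n) r₁).exists_bound_of_continuousOn
    ((hgc.mul (hF.norm.pow 2)).mono (Metric.closedBall_subset_ball hr₁1))
  have hM' : ∀ z : Cn n, ‖z‖ ≤ r₁ → g ‖z‖ * ‖F z‖ ^ 2 ≤ M := fun z hz =>
    (le_abs_self _).trans (hM z (by simpa using hz))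
  -- Induction on the number of steps known to bring the orbit into the compact ball where M bounds
  -- the quantity.
  have hiter : ∀ k, ∀ z ∈ unitBall n, ‖φ^[k] z‖ ≤ r₁ → g ‖z‖ * ‖F z‖ ^ 2 ≤ M := by
    intro k
    induction k with
    | zero => intro z _ hz; exact hM' z hz
    | succ k ih =>
      intro z hz hk
      rcases le_or_gt ‖z‖ r₁ with h | h
      · exact hM' z h
      · exact (hstep z hz h).trans (ih (φ z) (hmaps hz) (by rwa [Function.iterate_succ_apply] at hk))
  refine ⟨M, fun z hz => ?_⟩
  obtain ⟨K, -, hK⟩ := horb ‖z‖ (by simpa using hz)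
  have ht : Tendsto (fun k => K * α ^ k * ‖z‖) atTop (𝓝 0) := by
    simpa using ((tendsto_pow_atTop_nhds_zero_of_lt_one hα.le hα1).const_mul K).mul_const ‖z‖
  obtain ⟨k, hk⟩ := (ht.eventually_lt_const hr₁0).exists
  exact hiter k z hz ((hK z le_rfl k).trans hk.le)

/-! ### Compact composition operators and the Fredholm alternative -/

/-- The classes in `L²` of analytic functions on the ball vanishing to order `m` at the origin. -/
noncomputable def vanishingBergmanSpace {n : ℕ} (G : Cn n → ℝ) (m : ℕ) :
    Submodule ℂ (Lp ℂ 2 (weightMeasure G)) where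
  carrier := {f | ∃ g : Cn n → ℂ, AnalyticOnNhd ℂ g (unitBall n) ∧
    (g =O[𝓝 0] fun z => ‖z‖ ^ m) ∧ f =ᵐ[weightMeasure G] g}
  zero_mem' := ⟨fun _ => 0, analyticOnNhd_const, Asymptotics.isBigO_zero _ _, Lp.coeFn_zero _ _ _⟩
  add_mem' := by
    rintro f₁ f₂ ⟨g₁, h₁, o₁, e₁⟩ ⟨g₂, h₂, o₂, e₂⟩
    exact ⟨g₁ + g₂, h₁.add h₂, o₁.add o₂, (Lp.coeFn_add f₁ f₂).trans (e₁.add e₂)⟩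
  smul_mem' := by
    rintro c f ⟨g, h, o, e⟩
    exact ⟨c • g, h.const_smul, o.const_smul_left c, (Lp.coeFn_smul c f).trans (e.const_smul c)⟩

/-- Boundedness of point evaluations turns L² convergence into locally uniform convergence, so the
limit is analytic. The higher order Schwarz lemma bounds each term by a multiple of |w|^(m+1)
proportional to its norm, so the order of vanishing survives. Closedness gives completeness and
keeps the restricted operator compact. -/
theorem isClosed_vanishingBergmanSpace {n : ℕ} {G : Cn n → ℝ}
    (hGc : ContinuousOn G (unitBall n)) (hG : ∀ z ∈ unitBall n, 0 < G z) (m : ℕ) :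
    IsClosed (vanishingBergmanSpace G (m + 1) : Set (Lp ℂ 2 (weightMeasure G))) := by
  refine IsSeqClosed.isClosed fun f f' hf hlim => ?_
  choose g hga hgO hfg using hf
  have hsub : ∀ k l, (f k - f l : Lp ℂ 2 (weightMeasure G)) =ᵐ[weightMeasure G]
      fun z => g k z - g l z := fun k l =>
    (Lp.coeFn_sub _ _).trans ((hfg k).sub (hfg l))
  have hev : ∀ r, 0 ≤ r → r < 1 → ∃ C, 0 ≤ C ∧ ∀ k l (w : Cn n), ‖w‖ ≤ r →
      dist (g k w) (g l w) ≤ C * dist (f k) (f l) := by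
    intro r hr0 hr
    obtain ⟨C, hC0, hC⟩ := exists_norm_le_mul_Lp_norm hGc hG hr0 hr
    refine ⟨C, hC0, fun k l w hw => ?_⟩
    rw [dist_eq_norm, dist_eq_norm]
    exact hC _ _ ((hga k).sub (hga l)) (hsub k l) w hw
  have hptlim : ∀ w ∈ unitBall n, ∃ l, Tendsto (fun k => g k w) atTop (𝓝 l) := by
    intro w hw
    obtain ⟨C, hC0, hC⟩ := hev ‖w‖ (norm_nonneg _) (by simpa using hw)
    refine cauchySeq_tendsto_of_complete (Metric.cauchySeq_iff.2 fun ε hε => ?_)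
    obtain ⟨N, hN⟩ := Metric.cauchySeq_iff.1 hlim.cauchySeq (ε / (C + 1)) (by positivity)
    refine ⟨N, fun k hk l hl => (hC k l w le_rfl).trans_lt ?_⟩
    have h1 := hN k hk l hl
    rw [lt_div_iff₀ (by positivity)] at h1
    nlinarith [dist_nonneg (x := f k) (y := f l)]
  choose! g' hg' using hptlim
  have hdist : ∀ r, 0 ≤ r → r < 1 → ∃ C, 0 ≤ C ∧ ∀ k (w : Cn n), ‖w‖ ≤ r →
      dist (g k w) (g' w) ≤ C * dist (f k) f' := by
    intro r hr0 hr
    obtain ⟨C, hC0, hC⟩ := hev r hr0 hr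
    refine ⟨C, hC0, fun k w hw => ?_⟩
    have hwb : w ∈ unitBall n := by rw [mem_ball_zero_iff]; linarith
    exact le_of_tendsto_of_tendsto' (tendsto_const_nhds.dist (hg' w hwb))
      ((tendsto_const_nhds.dist hlim).const_mul C) fun l => hC k l w hw
  refine ⟨g', ?_, ?_, ?_⟩
  · refine TendstoLocallyUniformlyOn.analyticOnNhd_complex Metric.isOpen_ball hga ?_
    refine tendstoLocallyUniformlyOn_of_forall_exists_nhds fun x hx => ?_
    obtain ⟨r, hr1, hr2⟩ := exists_between (mem_ball_zero_iff.1 hx)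
    refine ⟨Metric.ball 0 r, nhdsWithin_le_nhds (Metric.isOpen_ball.mem_nhds (by simpa using hr1)),
      ?_⟩
    obtain ⟨C, -, hC⟩ := hdist r ((norm_nonneg _).trans hr1.le) hr2
    rw [Metric.tendstoUniformlyOn_iff]
    intro ε hε
    have ht : Tendsto (fun k => C * dist (f k) f') atTop (𝓝 0) := by
      simpa using (tendsto_iff_dist_tendsto_zero.1 hlim).const_mul C
    filter_upwards [ht.eventually_lt_const hε] with k hk z hz
    rw [dist_comm]
    exact (hC k z (mem_ball_zero_iff.1 hz).le).trans_lt hk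
  · obtain ⟨C, hC0, hC⟩ := exists_norm_le_mul_Lp_norm hGc hG (r := 1 / 2) (by norm_num)
      (by norm_num)
    have hk : ∀ k, ∀ w ∈ Metric.ball (0 : Cn n) (1 / 2),
        ‖g k w‖ ≤ C * ‖f k‖ * (‖w‖ / (1 / 2)) ^ (m + 1) := by
      intro k w hw
      have hg0 : g k 0 = 0 := (hgO k).eq_zero_imp.self_of_nhds (by simp)
      have hsubset : Metric.ball (0 : Cn n) (1 / 2) ⊆ unitBall n :=
        Metric.ball_subset_ball (by norm_num)
      have h1 := Complex.dist_le_mul_div_pow_of_mapsTo_ball_of_isLittleO (f := g k)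
        (R₂ := C * ‖f k‖) (n := m) ((hga k).differentiableOn.mono hsubset) ?_ ?_ hw
      · simpa [hg0] using h1
      · intro z hz
        rw [hg0, mem_closedBall_zero_iff]
        exact hC _ _ (hga k) (hfg k) z (mem_ball_zero_iff.1 hz).le
      · simp only [hg0, sub_zero]
        refine (hgO k).trans_isLittleO ?_
        have h2 : (fun z : Cn n => ‖z‖ ^ (m + 1)) = fun z => ‖z‖ * ‖z‖ ^ m := by
          ext z; rw [pow_succ']
        rw [h2]
        have h3 : (fun z : Cn n => ‖z‖) =o[𝓝 0] fun _ => (1 : ℝ) := by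
          rw [Asymptotics.isLittleO_one_iff]
          simpa using continuous_norm.tendsto (0 : Cn n)
        simpa using h3.mul_isBigO (Asymptotics.isBigO_refl (fun z : Cn n => ‖z‖ ^ m) (𝓝 0))
    refine Asymptotics.IsBigO.of_bound (C * ‖f'‖ * 2 ^ (m + 1)) ?_
    filter_upwards [Metric.ball_mem_nhds (0 : Cn n) (by norm_num : (0 : ℝ) < 1 / 2)] with w hw
    have hwb : w ∈ unitBall n := Metric.ball_subset_ball (by norm_num) hw
    have h1 := le_of_tendsto_of_tendsto' (hg' w hwb).norm
      ((hlim.norm.const_mul C).mul_const ((‖w‖ / (1 / 2)) ^ (m + 1))) fun k => hk k w hw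
    rw [norm_pow, norm_norm]
    refine h1.trans (le_of_eq ?_)
    rw [div_div_eq_mul_div, div_one, mul_pow]
    ring
  -- An almost everywhere convergent subsequence identifies the L² limit with the pointwise limit.
  · obtain ⟨ns, hns, hae⟩ := (tendstoInMeasure_of_tendsto_Lp hlim).exists_seq_tendsto_ae
    have hball : ∀ᵐ z ∂weightMeasure G, z ∈ unitBall n :=
      (ae_unitBall_eq_iff hGc hG).2 (ae_restrict_mem measurableSet_ball)
    filter_upwards [hae, hball, ae_all_iff.2 hfg] with z hz hzb hzfg
    refine tendsto_nhds_unique hz ?_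
    simp only [hzfg]
    exact (hg' z hzb).comp hns.tendsto_atTop

theorem isCompactOperator_sum {ι E F : Type*} [NormedAddCommGroup E] [NormedSpace ℂ E]
    [NormedAddCommGroup F] [NormedSpace ℂ F] (s : Finset ι) {K : ι → E →L[ℂ] F}
    (hK : ∀ i ∈ s, IsCompactOperator (K i)) : IsCompactOperator (∑ i ∈ s, K i : E →L[ℂ] F) :=
  Submodule.sum_mem (compactOperator (RingHom.id ℂ) E F) hK

theorem AnalyticOnNhd.apply_coord {n : ℕ} {H : Cn n → Cn n} {s : Set (Cn n)}
    (hH : AnalyticOnNhd ℂ H s) (i : Fin n) : AnalyticOnNhd ℂ (fun z => H z i) s :=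
  ((EuclideanSpace.proj i : Cn n →L[ℂ] ℂ).analyticOnNhd univ).comp hH (mapsTo_univ _ _)

/-- A matrix with compact operator entries is a compact operator. -/
theorem isCompactOperator_matrix {n : ℕ} {X : Type*} [NormedAddCommGroup X] [NormedSpace ℂ X]
    {T : X →L[ℂ] X} (hT : IsCompactOperator T) (a : Fin n → Fin n → ℂ) :
    ∃ K : (Fin n → X) →L[ℂ] (Fin n → X), IsCompactOperator K ∧
      ∀ h i, K h i = ∑ j, a i j • T (h j) := by
  refine ⟨∑ i, ∑ j, (ContinuousLinearMap.single ℂ (fun _ : Fin n => X) i) ∘L (a i j • T) ∘L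
    (ContinuousLinearMap.proj j), ?_, fun h i => ?_⟩
  · refine isCompactOperator_sum _ fun i _ => isCompactOperator_sum _ fun j _ => ?_
    exact ((hT.smul (a i j)).comp_clm (ContinuousLinearMap.proj (R := ℂ)
      (φ := fun _ : Fin n => X) j)).clm_comp (ContinuousLinearMap.single ℂ (fun _ : Fin n => X) i)
  · simp only [sum_apply, Finset.sum_apply, ContinuousLinearMap.comp_apply,
      ContinuousLinearMap.single_apply]
    rw [Finset.sum_eq_single i]
    · simp
    · intro i' _ hi'
      exact Finset.sum_eq_zero fun j _ => Pi.single_eq_of_ne (Ne.symm hi') _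
    · simp

/-- A compact composition operator restricts to a compact operator on the functions vanishing to
order `m + 1` at the origin. -/
theorem exists_compact_on_vanishingBergmanSpace {n : ℕ} {φ : Cn n → Cn n} {G : Cn n → ℝ}
    (hφ : AnalyticOnNhd ℂ φ (unitBall n)) (hmaps : MapsTo φ (unitBall n) (unitBall n))
    (hle : ∀ z ∈ unitBall n, ‖φ z‖ ≤ ‖z‖)
    (hGc : ContinuousOn G (unitBall n)) (hG : ∀ z ∈ unitBall n, 0 < G z)
    (hcomp : CompositionCompact φ G) (m : ℕ) :
    ∃ T : vanishingBergmanSpace G (m + 1) →L[ℂ] vanishingBergmanSpace G (m + 1),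
      IsCompactOperator T ∧
      ∀ (f : vanishingBergmanSpace G (m + 1)) (g : Cn n → ℂ), AnalyticOnNhd ℂ g (unitBall n) →
      (f : Lp ℂ 2 (weightMeasure G)) =ᵐ[weightMeasure G] g →
      (T f : Lp ℂ 2 (weightMeasure G)) =ᵐ[weightMeasure G] g ∘ φ := by
  obtain ⟨T, hT, hTφ⟩ := hcomp
  let ι : vanishingBergmanSpace G (m + 1) →L[ℂ] bergmanSpace G :=
    (vanishingBergmanSpace G (m + 1)).subtypeL.codRestrict (bergmanSpace G)
      fun f => by
        obtain ⟨g, h, -, e⟩ := f.2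
        exact ⟨g, h, e⟩
  let T₁ : vanishingBergmanSpace G (m + 1) →L[ℂ] Lp ℂ 2 (weightMeasure G) :=
    (bergmanSpace G).subtypeL ∘L T ∘L ι
  have hT₁φ : ∀ f (g : Cn n → ℂ), AnalyticOnNhd ℂ g (unitBall n) →
      ((f : vanishingBergmanSpace G (m + 1)) : Lp ℂ 2 (weightMeasure G)) =ᵐ[weightMeasure G] g →
      T₁ f =ᵐ[weightMeasure G] g ∘ φ := fun f g hg hfg => hTφ (ι f) g hg hfg
  have h0 : φ 0 = 0 := norm_le_zero_iff.1 (by simpa using hle 0 (by simp))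
  have ht : Tendsto φ (𝓝 0) (𝓝 0) := by
    have := (hφ 0 (by simp)).continuousAt.tendsto
    rwa [h0] at this
  have hmem : ∀ f, T₁ f ∈ vanishingBergmanSpace G (m + 1) := by
    intro f
    obtain ⟨g, hg, hgO, hfg⟩ := f.2
    refine ⟨g ∘ φ, hg.comp hφ hmaps, (hgO.comp_tendsto ht).trans ?_, hT₁φ f g hg hfg⟩
    refine Asymptotics.IsBigO.of_bound 1 ?_
    filter_upwards [Metric.ball_mem_nhds (0 : Cn n) one_pos] with z hz
    simp only [Function.comp_apply, norm_pow, norm_norm, one_mul]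
    gcongr
    exact hle z hz
  have hT₁ : IsCompactOperator T₁ := (hT.comp_clm ι).clm_comp (bergmanSpace G).subtypeL
  exact ⟨T₁.codRestrict _ hmem,
    hT₁.codRestrict hmem (isClosed_vanishingBergmanSpace hGc hG m), hT₁φ⟩

/-- For compact K, the number 1 is an eigenvalue or lies in the resolvent set; the first is excluded
by `hfix`. -/
theorem exists_surjective_sub_of_isCompactOperator {X : Type*} [NormedAddCommGroup X]
    [NormedSpace ℂ X] [CompleteSpace X] {K : X →L[ℂ] X} (hK : IsCompactOperator K)
    (hfix : ∀ x, K x = x → x = 0) : ∀ y, ∃ x, x - K x = y := by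
  rcases hK.hasEigenvalue_or_mem_resolventSet (one_ne_zero (α := ℂ)) with h | h
  · obtain ⟨x, hx⟩ := h.exists_hasEigenvector
    exact absurd (hfix x (by simpa using hx.apply_eq_smul)) hx.2
  · rw [spectrum.mem_resolventSet_iff, ContinuousLinearMap.isUnit_iff_bijective] at h
    exact fun y => by simpa using h.2 y

/-- The Fredholm alternative for a matrix whose entries are multiples of a compact operator. -/
theorem exists_sub_matrix_smul_eq {n : ℕ} {X : Type*} [NormedAddCommGroup X] [NormedSpace ℂ X]
    [CompleteSpace X] {T : X →L[ℂ] X} (hT : IsCompactOperator T) (a : Fin n → Fin n → ℂ)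
    (hfix : ∀ h : Fin n → X, (∀ i, ∑ j, a i j • T (h j) = h i) → h = 0) (y : Fin n → X) :
    ∃ h : Fin n → X, ∀ i, h i - ∑ j, a i j • T (h j) = y i := by
  obtain ⟨K, hK, hKa⟩ := isCompactOperator_matrix hT a
  have hfix' : ∀ h, K h = h → h = 0 := fun h hh => hfix h fun i => by rw [← hKa, hh]
  obtain ⟨h, hh⟩ := exists_surjective_sub_of_isCompactOperator (K := K) hK hfix' y
  exact ⟨h, fun i => by rw [← hKa, ← hh, Pi.sub_apply]⟩

/-- A vector of classes of analytic functions, and its image under the composition operator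
combined with a matrix, have analytic representatives. -/
theorem exists_analytic_representatives {n m : ℕ} {φ : Cn n → Cn n} {G : Cn n → ℝ}
    {T : vanishingBergmanSpace G m →L[ℂ] vanishingBergmanSpace G m}
    (hTφ : ∀ (f : vanishingBergmanSpace G m) (g : Cn n → ℂ), AnalyticOnNhd ℂ g (unitBall n) →
      (f : Lp ℂ 2 (weightMeasure G)) =ᵐ[weightMeasure G] g →
      (T f : Lp ℂ 2 (weightMeasure G)) =ᵐ[weightMeasure G] g ∘ φ)
    (B : Cn n →L[ℂ] Cn n)
    (h : Fin n → vanishingBergmanSpace G m) :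
    ∃ H : Cn n → Cn n, AnalyticOnNhd ℂ H (unitBall n) ∧ (H =O[𝓝 0] fun z => ‖z‖ ^ m) ∧
      (∀ i, (h i : Lp ℂ 2 (weightMeasure G)) =ᵐ[weightMeasure G] fun z => H z i) ∧
      ∀ i, ((∑ j, B (EuclideanSpace.single j 1) i • T (h j) : vanishingBergmanSpace G m) :
        Lp ℂ 2 (weightMeasure G)) =ᵐ[weightMeasure G] fun z => B (H (φ z)) i := by
  let a : Fin n → Fin n → ℂ := fun i j => B (EuclideanSpace.single j 1) i
  choose q hq hqO hqe using fun i => (h i).2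
  let L : (Fin n → ℂ) →L[ℂ] Cn n := (PiLp.continuousLinearEquiv 2 ℂ (fun _ : Fin n => ℂ)).symm
  refine ⟨fun z => L fun i => q i z, ?_, ?_, hqe, fun i => ?_⟩
  · exact (L.analyticOnNhd univ).comp (fun z hz => analyticAt_pi_iff.2 fun i => hq i z hz)
      (mapsTo_univ _ _)
  · exact (L.isBigO_comp _ (𝓝 0)).trans (Asymptotics.isBigO_pi.2 hqO)
  · have h1 : ∀ᵐ z ∂weightMeasure G, ∀ j,
        ((T (h j) : vanishingBergmanSpace G m) : Lp ℂ 2 (weightMeasure G)) z = q j (φ z) :=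
      ae_all_iff.2 fun j => hTφ (h j) (q j) (hq j) (hqe j)
    have h2 : ((∑ j, B (EuclideanSpace.single j 1) i • T (h j) : vanishingBergmanSpace G m) : Lp ℂ 2 (weightMeasure G)) =
        ∑ j, a i j • ((T (h j) : vanishingBergmanSpace G m) : Lp ℂ 2 (weightMeasure G)) := by
      simp [a]
    have h3 : ∀ᵐ z ∂weightMeasure G, ∀ j, (a i j • ((T (h j) : vanishingBergmanSpace G m) : Lp ℂ 2 (weightMeasure G)) :
        Lp ℂ 2 (weightMeasure G)) z = a i j * ((T (h j) : vanishingBergmanSpace G m) : Lp ℂ 2 (weightMeasure G)) z :=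
      ae_all_iff.2 fun j => Lp.coeFn_smul _ _
    rw [h2]
    filter_upwards [h1, h3, Lp.coeFn_fun_finsetSum Finset.univ fun j =>
      a i j • ((T (h j) : vanishingBergmanSpace G m) : Lp ℂ 2 (weightMeasure G))] with z hz1 hz3 hz4
    rw [hz4, apply_eq_sum_single B]
    refine Finset.sum_congr rfl fun j _ => ?_
    rw [hz3, hz1]
    rfl

theorem memLp_of_continuous {n : ℕ} {G : Cn n → ℝ} (hG : BergmanWeight G) {f : Cn n → ℂ}
    (hf : ContinuousOn f (unitBall n)) {M : ℝ} (hM : ∀ z ∈ unitBall n, ‖f z‖ ≤ M) :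
    MemLp f 2 (weightMeasure G) := by
  refine memLp_weightMeasure_of_le hG.continuousOn hG.pos hf (hG.integrableOn.mul_const (M ^ 2))
    fun z hz => ?_
  have := hG.pos z hz
  have := hM z hz
  gcongr

/-- If the composition operator is compact, then the linearized Schroeder equation with a right
hand side of high order is solvable in the weighted Bergman space, by the Fredholm alternative. -/
theorem exists_correction_of_compositionCompact {n m : ℕ} {φ : Cn n → Cn n}
    (hφ : AnalyticOnNhd ℂ φ (unitBall n)) (hmaps : MapsTo φ (unitBall n) (unitBall n))
    (hle : ∀ z ∈ unitBall n, ‖φ z‖ ≤ ‖z‖)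
    (A : Cn n ≃L[ℂ] Cn n) {α : ℝ} (hα : 0 < α)
    (horb : ∀ r < 1, ∃ K, 0 ≤ K ∧ ∀ z : Cn n, ‖z‖ ≤ r → ∀ k, ‖φ^[k] z‖ ≤ K * α ^ k * ‖z‖)
    (hm : ‖(A.symm : Cn n →L[ℂ] Cn n)‖ * α ^ (m + 1) < 1)
    {G : Cn n → ℝ} (hGc : ContinuousOn G (unitBall n)) (hGp : ∀ z ∈ unitBall n, 0 < G z)
    (hcomp : CompositionCompact φ G) {W : Cn n → Cn n} (hWa : AnalyticOnNhd ℂ W (unitBall n))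
    (hWO : W =O[𝓝 0] fun z => ‖z‖ ^ (m + 1))
    (hWmem : ∀ i, MemLp (fun z => W z i) 2 (weightMeasure G)) :
    ∃ H : Cn n → Cn n, AnalyticOnNhd ℂ H (unitBall n) ∧ (H =O[𝓝 0] fun z => ‖z‖ ^ (m + 1)) ∧
      (∀ z ∈ unitBall n, H z - A.symm (H (φ z)) = W z) ∧
      ∀ i, MemLp (fun z => H z i) 2 (weightMeasure G) := by
  have : CompleteSpace (vanishingBergmanSpace G (m + 1)) :=
    (isClosed_vanishingBergmanSpace hGc hGp m).completeSpace_coe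
  obtain ⟨T, hT, hTφ⟩ := exists_compact_on_vanishingBergmanSpace hφ hmaps hle hGc hGp hcomp m
  have hrep := exists_analytic_representatives hTφ (A.symm : Cn n →L[ℂ] Cn n)
  have hcompA : ∀ H : Cn n → Cn n, AnalyticOnNhd ℂ H (unitBall n) →
      AnalyticOnNhd ℂ (fun z => A.symm (H (φ z))) (unitBall n) := fun H hH =>
    ((A.symm : Cn n →L[ℂ] Cn n).analyticOnNhd univ).comp (hH.comp hφ hmaps) (mapsTo_univ _ _)
  -- A fixed vector of A⁻¹C_φ is an exact solution of Schroeder's equation vanishing to order m + 1,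
  -- hence zero.
  have hfix : ∀ h : Fin n → vanishingBergmanSpace G (m + 1),
      (∀ i, ∑ j, (A.symm : Cn n →L[ℂ] Cn n) (EuclideanSpace.single j 1) i • T (h j) = h i) →
        h = 0 := by
    intro h hh
    obtain ⟨H, hHa, hHO, hHe, hHK⟩ := hrep h
    simp only [hh] at hHK
    have heq : ∀ z ∈ unitBall n, H (φ z) = A (H z) := by
      intro z hz
      apply A.symm.injective
      rw [A.symm_apply_apply]
      ext i
      exact eqOn_unitBall_of_ae_eq hGc hGp ((hcompA H hHa).apply_coord i).continuousOn
        (hHa.apply_coord i).continuousOn ((hHK i).symm.trans (hHe i)) hz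
    have hzero := schroeder_eq_zero_of_isBigO hmaps A hα horb hle hm hHa.continuousOn heq hHO
    funext i
    apply Subtype.ext
    apply Lp.ext
    refine (hHe i).trans ((ae_eq_of_eqOn_unitBall hGc hGp fun z hz => ?_).trans
      (Lp.coeFn_zero _ _ _).symm)
    simp [hzero z hz]
  obtain ⟨h, hh⟩ := exists_sub_matrix_smul_eq hT _ hfix
    fun i => ⟨(hWmem i).toLp, fun z => W z i, hWa.apply_coord i,
      ((EuclideanSpace.proj i : Cn n →L[ℂ] ℂ).isBigO_comp W (𝓝 0)).trans hWO,
      (hWmem i).coeFn_toLp⟩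
  obtain ⟨H, hHa, hHO, hHe, hHK⟩ := hrep h
  refine ⟨H, hHa, hHO, fun z hz => ?_, fun i => (memLp_congr_ae (hHe i)).1 (Lp.memLp _)⟩
  ext i
  refine eqOn_unitBall_of_ae_eq hGc hGp (f := fun z => (H z - A.symm (H (φ z))) i)
    ((hHa.sub (hcompA H hHa)).apply_coord i).continuousOn (hWa.apply_coord i).continuousOn ?_ hz
  have h1 := congrArg (Submodule.subtype _) (hh i)
  rw [map_sub] at h1
  simp only [Submodule.subtype_apply] at h1
  filter_upwards [hHe i, hHK i, Lp.coeFn_sub (h i : Lp ℂ 2 (weightMeasure G))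
    ((∑ j, (A.symm : Cn n →L[ℂ] Cn n) (EuclideanSpace.single j 1) i • T (h j) :
      vanishingBergmanSpace G (m + 1)) : Lp ℂ 2 (weightMeasure G)), (hWmem i).coeFn_toLp] with z h2 h3 h4 h5
  rw [h1, h5, Pi.sub_apply, h2, h3] at h4
  rw [h4]
  rfl

/-- If the composition operator is compact, then a solution of Schroeder's equation which agrees
with a polynomial map to high order lies in the weighted Bergman space. -/
theorem memLp_of_compositionCompact {n m : ℕ} {φ : Cn n → Cn n}
    (hφ : AnalyticOnNhd ℂ φ (unitBall n)) (hmaps : MapsTo φ (unitBall n) (unitBall n))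
    (hle : ∀ z ∈ unitBall n, ‖φ z‖ ≤ ‖z‖)
    (A : Cn n ≃L[ℂ] Cn n) {α : ℝ} (hα : 0 < α)
    (horb : ∀ r < 1, ∃ K, 0 ≤ K ∧ ∀ z : Cn n, ‖z‖ ≤ r → ∀ k, ‖φ^[k] z‖ ≤ K * α ^ k * ‖z‖)
    (hm : ‖(A.symm : Cn n →L[ℂ] Cn n)‖ * α ^ (m + 1) < 1)
    {P F : Cn n → Cn n} (hP : AnalyticOnNhd ℂ P univ)
    (hR : (fun z => P (φ z) - A (P z)) =O[𝓝 0] fun z => ‖z‖ ^ (m + 1))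
    (hF : AnalyticOnNhd ℂ F (unitBall n)) (hFA : ∀ z ∈ unitBall n, F (φ z) = A (F z))
    (hFP : (fun z => F z - P z) =O[𝓝 0] fun z => ‖z‖ ^ (m + 1))
    {G : Cn n → ℝ} (hG : BergmanWeight G) (hcomp : CompositionCompact φ G) (i : Fin n) :
    MemLp (fun z => F z i) 2 (weightMeasure G) := by
  have hPb : AnalyticOnNhd ℂ P (unitBall n) := hP.mono (subset_univ _)
  obtain ⟨MP, hMP⟩ := (isCompact_closedBall (0 : Cn n) 1).exists_bound_of_continuousOn
    (hP.continuousOn.mono (subset_univ _))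
  have hMP' : ∀ z ∈ unitBall n, ‖P z‖ ≤ MP := fun z hz => hMP z (Metric.ball_subset_closedBall hz)
  -- W is chosen so that H - A⁻¹(H ∘ φ) = W says exactly that P + H solves Schroeder's equation.
  set W : Cn n → Cn n := fun z => A.symm (P (φ z)) - P z with hW
  have hWa : AnalyticOnNhd ℂ W (unitBall n) :=
    (((A.symm : Cn n →L[ℂ] Cn n).analyticOnNhd univ).comp (hPb.comp hφ hmaps)
      (mapsTo_univ _ _)).sub hPb
  have hWO : W =O[𝓝 0] fun z => ‖z‖ ^ (m + 1) := by
    refine (((A.symm : Cn n →L[ℂ] Cn n).isBigO_comp _ (𝓝 0)).trans hR).congr_left fun z => ?_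
    simp [hW]
  have hWb : ∀ z ∈ unitBall n, ‖W z‖ ≤ ‖(A.symm : Cn n →L[ℂ] Cn n)‖ * MP + MP := by
    intro z hz
    refine (norm_sub_le _ _).trans (add_le_add ?_ (hMP' z hz))
    refine ((A.symm : Cn n →L[ℂ] Cn n).le_opNorm _).trans ?_
    gcongr
    exact hMP' _ (hmaps hz)
  obtain ⟨H, hHa, hHO, heq, hHmem⟩ := exists_correction_of_compositionCompact hφ hmaps hle A hα
    horb hm hG.continuousOn hG.pos hcomp hWa hWO fun i =>
      memLp_of_continuous hG (hWa.apply_coord i).continuousOn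
        fun z hz => (PiLp.norm_apply_le _ i).trans (hWb z hz)
  -- F and P + H are both exact solutions and agree to order m + 1, so they coincide.
  have hD := schroeder_eq_zero_of_isBigO (D := fun z => F z - P z - H z) hmaps A hα horb hle hm
    ((hF.sub hPb).sub hHa).continuousOn (fun z hz => by
      have h1 := congrArg A (heq z hz)
      simp only [hW, map_sub, A.apply_symm_apply] at h1
      rw [map_sub, map_sub, hFA z hz]
      have h2 : A (H z) = H (φ z) + (P (φ z) - A (P z)) := by rw [← h1]; abel
      rw [h2]; abel)
    (hFP.sub hHO)
  have hFi : (fun z => F z i) =ᵐ[weightMeasure G] fun z => P z i + H z i := by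
    refine ae_eq_of_eqOn_unitBall hG.continuousOn hG.pos fun z hz => ?_
    have h1 : F z = P z + H z := by
      have := hD z hz
      rw [sub_sub, sub_eq_zero] at this
      exact this
    simp [h1]
  refine (memLp_congr_ae hFi).2 (MemLp.add ?_ (hHmem i))
  exact memLp_of_continuous hG (hPb.apply_coord i).continuousOn
    fun z hz => (PiLp.norm_apply_le _ i).trans (hMP' z hz)

/-! ### Assembly -/

theorem mainTheorem3 (n : ℕ) (φ : Cn n → Cn n)
    (hφ : AnalyticOnNhd ℂ φ (unitBall n))
    (hmaps : MapsTo φ (unitBall n) (unitBall n))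
    (h0 : φ 0 = 0)
    (hinv : (fderiv ℂ φ 0).IsInvertible)
    (hslice : ¬ UnitaryOnSomeSlice φ) :
    ∃ F : Cn n → Cn n,
      AnalyticOnNhd ℂ F (unitBall n) ∧
      (∀ z ∈ unitBall n, F (φ z) = fderiv ℂ φ 0 (F z)) ∧
      (∀ g : ℝ → ℝ, RapidlyDecreasingWeight n g →
        ComponentsLinearIndependent F (fun z => g ‖z‖)) ∧
      (∀ G : Cn n → ℝ, BergmanWeight G → CompositionCompact φ G →
        ComponentsLinearIndependent F G) := by
  obtain ⟨A, hA⟩ := hinv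
  have hAv : ∀ v, fderiv ℂ φ 0 v = A v := fun v => by rw [← hA]; rfl
  obtain ⟨c, hc, hc1, hφc⟩ := exists_norm_le_mul_one_sub hφ hmaps h0
    (norm_fderiv_lt_one_of_not_unitaryOnSomeSlice hφ hmaps h0 hslice)
  obtain ⟨α, hα, hα1, horb⟩ := exists_iterate_norm_le hc hc1 hφc
  have hle : ∀ z ∈ unitBall n, ‖φ z‖ ≤ ‖z‖ := by
    intro z hz
    have hz1 : ‖z‖ < 1 := by simpa using hz
    exact (hφc z hz).trans (mul_le_of_le_one_right (norm_nonneg _) (by nlinarith))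
  -- The order m + 1 depends on φ alone, so one F serves all weights; m ≥ 1 ensures that jets of
  -- this order determine the derivative at 0.
  obtain ⟨m, hm2, hm⟩ : ∃ m : ℕ, 1 ≤ m ∧ ‖(A.symm : Cn n →L[ℂ] Cn n)‖ * α ^ (m + 1) < 1 := by
    have ht : Tendsto (fun m : ℕ => ‖(A.symm : Cn n →L[ℂ] Cn n)‖ * α ^ (m + 1)) atTop (𝓝 0) := by
      simpa using ((tendsto_pow_atTop_nhds_zero_of_lt_one hα.le hα1).comp
        (tendsto_add_atTop_nat 1)).const_mul ‖(A.symm : Cn n →L[ℂ] Cn n)‖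
    exact ((eventually_ge_atTop 1).and (ht.eventually_lt_const one_pos)).exists
  obtain ⟨P, hP, hR, hind⟩ := exists_approx_schroeder hφ hmaps hle (m := m + 1) (by omega)
  simp only [hAv] at hR ⊢
  obtain ⟨F, hF, hFA, hFP⟩ := exists_schroeder_of_approx hφ hmaps A hα horb hle hm
    (hP.mono (subset_univ _)) hR
  have hindF : ∀ c : Fin n → ℂ,
      ((fun z => ∑ i, c i * F z i) =O[𝓝 0] fun z => ‖z‖ ^ (m + 1)) → c = 0 := by
    intro c hcF
    apply hind
    have h1 : (fun z => ∑ i, c i * (F z - P z) i) =O[𝓝 0] fun z => ‖z‖ ^ (m + 1) := by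
      refine Asymptotics.IsBigO.fun_sum fun i _ => Asymptotics.IsBigO.const_mul_left ?_ _
      exact ((EuclideanSpace.proj i : Cn n →L[ℂ] ℂ).isBigO_comp _ (𝓝 0)).trans hFP
    refine (hcF.sub h1).congr_left fun z => ?_
    rw [← Finset.sum_sub_distrib]
    refine Finset.sum_congr rfl fun i _ => ?_
    simp only [PiLp.sub_apply]
    ring
  refine ⟨F, hF, hFA, fun g hg => ?_, fun G hG hcomp => ?_⟩
  · have hgc : ContinuousOn (fun z : Cn n => g ‖z‖) (unitBall n) :=
      hg.continuousOn.comp continuous_norm.continuousOn fun z hz =>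
        ⟨norm_nonneg z, by simpa using hz⟩
    have hgp : ∀ z ∈ unitBall n, 0 < g ‖z‖ := fun z hz =>
      hg.pos _ ⟨norm_nonneg z, by simpa using hz⟩
    refine componentsLinearIndependent_of_memLp hgc hgp hF hindF fun i => ?_
    -- For n = 0 there is no component to check; otherwise the exponent 2n is positive, as the
    -- growth estimate needs.
    have hn : n ≠ 0 := by rintro rfl; exact i.elim0
    obtain ⟨M, hM⟩ := exists_weight_mul_norm_sq_le hn hmaps hc hφc hα hα1 horb A hF.continuousOn
      hFA hg hgc
    refine memLp_weightMeasure_of_le hgc hgp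
      (((EuclideanSpace.proj i : Cn n →L[ℂ] ℂ).continuous).comp_continuousOn hF.continuousOn)
      (u := fun _ => M) (integrableOn_const measure_ball_lt_top.ne) fun z hz => ?_
    refine le_trans ?_ (hM z hz)
    have := hgp z hz
    gcongr
    exact PiLp.norm_apply_le (F z) i
  · exact componentsLinearIndependent_of_memLp hG.continuousOn hG.pos hF hindF fun i =>
      memLp_of_compositionCompact hφ hmaps hle A hα horb hm hP hR hF hFA hFP hG hcomp i
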